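/- Let $\nu\ge 1$ and let $\mathcal A$ be the Fermion (CAR) $C^*$-algebra over $\mathbb Z^\nu$: a (nonzero) unital $C^*$-algebra generated, as a unital $C^*$-algebra, by elements $a_i$ ($i\in\mathbb Z^\nu$) satisfying $a_i^*a_j+a_ja_i^*=\delta_{ij}1$ and $a_ia_j+a_ja_i=a_i^*a_j^*+a_j^*a_i^*=0$. For $I\subset\mathbb Z^\nu$ let $\mathcal A(I)$ be the unital $C^*$-subalgebra generated by the $a_i$, $i\in I$ (so $\mathcal A(\emptyset)=\mathbb C1$), and let $\mathcal A_\circ$ be the unital $*$-algebra generated by all $a_i$, i.e. the union of the $\mathcal A(I)$ over finite $I$. Let $\Theta$ be the unique $*$-automorphism of $\mathcal A$ with $\Theta(a_i)=-a_i$ for all $i$, let $\tau$ be the unique tracial state of $\mathcal A$, and for $I\subset\mathbb Z^\nu$ let $E_I:\mathcal A\to\mathcal A(I)$ be the conditional expectation determined by $\tau(xb)=\tau(E_I(x)b)$ for all $x\in\mathcal A$, $b\in\mathcal A(I)$. A standard ($\Theta$-even) potential is a function $\Phi$ from the finite subsets of $\mathbb Z^\nu$ to $\mathcal A$ such that, for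 all finite $I$: (a) $\Phi(I)\in\mathcal A(I)$, and $\Phi(\emptyset)=0$; (b) $\Phi(I)^*=\Phi(I)$; (c) $\Theta(\Phi(I))=\Phi(I)$; (d) $E_J(\Phi(I))=0$ whenever $J\subset I$ and $J\ne I$; (e) the net $H_J(I)=\sum\{\Phi(K):K\cap I\neq\emptyset,\ K\subset J\}$, indexed by the finite subsets $J$ of $\mathbb Z^\nu$ ordered by inclusion, is a Cauchy net in norm. Let $\mathcal P$ be the real vector space of all standard potentials. Let $\Delta(\mathcal A_\circ)$ be the real vector space of all complex-linear maps $\delta:\mathcal A_\circ\to\mathcal A$ with $\delta(xy)=\delta(x)y+x\delta(y)$, $\delta(x^*)=\delta(x)^*$ and $\delta(\Theta(x))=\Theta(\delta(x))$ for all $x,y\in\mathcal A_\circ$. Theorem. The relation $$\delta_\Phi A=i[H(I),A]\quad(A\in\mathcal A(I),\ I\subset\mathbb Z^\nu\text{ finite}),\qquad H(I)=\lim_{J\nearrow\mathbb Z^\nu}\sum\{\Phi(K):K\cap I\ne\emptyset,\ K\subset J\},$$ (limit in norm along the net of finite subsets $J$) between $\Phi\in\mathcal P$ and $\delta_\Phi\in\Delta(\mathcal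 A_\circ)$ is the graph of a bijective real-linear map from $\mathcal P$ onto $\Delta(\mathcal A_\circ)$. -/

import Mathlib

open Filter Topology

noncomputable section

namespace FermionLattice

variable {Λ : Type*} {A : Type*} [CStarAlgebra A]

/-- `A` is the Fermion (CAR) C*-algebra over the set of sites `Λ`, with annihilation operators `a i`
and creation operators `star (a i)`: the canonical anticommutation relations hold and `A` is
generated, as a unital C*-algebra, by the `a i`. (`A` is a unital C*-algebra by the ambient
`CStarAlgebra A`; that it is not the zero algebra is the separate assumption `Nontrivial A`.) -/
structure IsFermionAlgebra [DecidableEq Λ] (a : Λ → A) : Prop where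
  star_mul_add_mul_star : ∀ i j, star (a i) * a j + a j * star (a i) = if i = j then 1 else 0
  mul_add_mul : ∀ i j, a i * a j + a j * a i = 0
  star_mul_star_add : ∀ i j, star (a i) * star (a j) + star (a j) * star (a i) = 0
  generates : (StarAlgebra.adjoin ℂ (Set.range a)).topologicalClosure = ⊤

/-- The C*-subalgebra `𝒜(I)` generated by the `a i`, `i ∈ I`, for an arbitrary set `I` of sites
(`𝒜(∅) = ℂ 1`). -/
def localAlgebra (a : Λ → A) (I : Set Λ) : StarSubalgebra ℂ A :=
  (StarAlgebra.adjoin ℂ (a '' I)).topologicalClosure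

/-- The strictly local algebra `𝒜_∘`: the (algebraic) *-algebra generated by all `a i`. -/
def strictlyLocal (a : Λ → A) : StarSubalgebra ℂ A :=
  StarAlgebra.adjoin ℂ (Set.range a)

/-- The even-oddness automorphism `Θ`: the unique *-automorphism with `Θ (a i) = - a i`. -/
def evenOdd (a : Λ → A) : A ≃⋆ₐ[ℂ] A :=
  @Classical.epsilon _ ⟨StarAlgEquiv.refl ℂ A⟩ fun θ : A ≃⋆ₐ[ℂ] A => ∀ i, θ (a i) = -a i

/-- Tracial states: positive, normalized linear functionals with `τ (x y) = τ (y x)`. -/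
structure IsTracialState (τ : A →ₗ[ℂ] ℂ) : Prop where
  map_one : τ 1 = 1
  nonneg : ∀ x, 0 ≤ (τ (star x * x)).re ∧ (τ (star x * x)).im = 0
  tracial : ∀ x y, τ (x * y) = τ (y * x)

variable (A) in
/-- The tracial state `τ` (for the Fermion algebra there is exactly one). -/
def trace : A →ₗ[ℂ] ℂ :=
  Classical.epsilon fun τ : A →ₗ[ℂ] ℂ => IsTracialState τ

/-- The conditional expectation `E_I : 𝒜 → 𝒜(I)` with respect to the tracial state: the unique
(linear) map with `E_I x ∈ 𝒜(I)` and `τ (x b) = τ (E_I x b)` for all `b ∈ 𝒜(I)`. -/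
def condExp (a : Λ → A) (I : Set Λ) : A →ₗ[ℂ] A :=
  Classical.epsilon fun E : A →ₗ[ℂ] A =>
    ∀ x, E x ∈ localAlgebra a I ∧ ∀ b ∈ localAlgebra a I, trace A (x * b) = trace A (E x * b)

/-- `H_J(I) = ∑ {Φ(K) ; K ∩ I ≠ ∅, K ⊆ J}`. -/
def partialHamiltonian [DecidableEq Λ] (Φ : Finset Λ → A) (I J : Finset Λ) : A :=
  ∑ K ∈ J.powerset with (K ∩ I).Nonempty, Φ K

/-- Standard (`Θ`-even) potentials. -/
structure IsStandardPotential [DecidableEq Λ] (a : Λ → A) (Φ : Finset Λ → A) : Prop where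
  mem : ∀ I : Finset Λ, Φ I ∈ localAlgebra a (I : Set Λ)
  empty : Φ ∅ = 0
  selfAdjoint : ∀ I, star (Φ I) = Φ I
  even : ∀ I, evenOdd a (Φ I) = Φ I
  standard : ∀ I J : Finset Λ, J ⊆ I → J ≠ I → condExp a (J : Set Λ) (Φ I) = 0
  cauchy : ∀ I : Finset Λ, CauchySeq fun J : Finset Λ => partialHamiltonian Φ I J

/-- The real vector space `𝒫` of standard potentials. -/
def standardPotentials [DecidableEq Λ] (a : Λ → A) : Submodule ℝ (Finset Λ → A) where
  carrier := {Φ | IsStandardPotential a Φ}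
  zero_mem' := by
    refine ⟨fun I => zero_mem _, rfl, fun I => by simp, fun I => by simp, fun I J _ _ => by simp,
      fun I => ?_⟩
    simpa [partialHamiltonian] using cauchySeq_const (0 : A)
  add_mem' := by
    intro Φ Ψ hΦ hΨ
    refine ⟨fun I => add_mem (hΦ.mem I) (hΨ.mem I), by simp [hΦ.empty, hΨ.empty],
      fun I => by simp [hΦ.selfAdjoint, hΨ.selfAdjoint], fun I => by simp [hΦ.even, hΨ.even],
      fun I J h h' => by simp [hΦ.standard I J h h', hΨ.standard I J h h'], fun I => ?_⟩
    have := (hΦ.cauchy I).add (hΨ.cauchy I)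
    simpa [partialHamiltonian, Finset.sum_add_distrib, Pi.add_def] using this
  smul_mem' := by
    intro c Φ hΦ
    have key : ∀ x : A, c • x = (c : ℂ) • x := fun x => (Complex.coe_smul c x).symm
    refine ⟨fun I => ?_, by simp [hΦ.empty],
      fun I => by simp [hΦ.selfAdjoint], fun I => ?_, fun I J h h' => ?_, fun I => ?_⟩
    · rw [Pi.smul_apply, key]
      exact SMulMemClass.smul_mem _ (hΦ.mem I)
    · rw [Pi.smul_apply, key, map_smul, hΦ.even]
    · rw [Pi.smul_apply, key, map_smul, hΦ.standard I J h h', smul_zero]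
    · have := (uniformContinuous_const_smul c).comp_cauchySeq (hΦ.cauchy I)
      simpa [partialHamiltonian, Finset.smul_sum, Function.comp_def] using this

/-- `δ : 𝒜_∘ → 𝒜` is a *-derivation commuting with `Θ`. In `evenOdd_comm` the element `y` is `Θ x`,
viewed in `𝒜_∘`, which `Θ` maps onto itself. -/
structure IsEvenStarDerivation (a : Λ → A) (δ : strictlyLocal a →ₗ[ℂ] A) : Prop where
  leibniz : ∀ x y : strictlyLocal a, δ (x * y) = δ x * (y : A) + (x : A) * δ y
  map_star : ∀ x : strictlyLocal a, δ (star x) = star (δ x)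
  evenOdd_comm : ∀ x y : strictlyLocal a, (y : A) = evenOdd a (x : A) → δ y = evenOdd a (δ x)

/-- The real vector space `Δ(𝒜_∘)` of *-derivations with domain `𝒜_∘` commuting with `Θ`. -/
def evenStarDerivations (a : Λ → A) : Submodule ℝ (strictlyLocal a →ₗ[ℂ] A) where
  carrier := {δ | IsEvenStarDerivation a δ}
  zero_mem' := ⟨fun x y => by simp, fun x => by simp, fun x y _ => by simp⟩
  add_mem' := by
    intro δ ε hδ hε
    refine ⟨fun x y => ?_, fun x => by simp [hδ.map_star, hε.map_star], fun x y h => ?_⟩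
    · simp only [LinearMap.add_apply, hδ.leibniz, hε.leibniz, add_mul, mul_add]
      abel
    · simp [hδ.evenOdd_comm x y h, hε.evenOdd_comm x y h]
  smul_mem' := by
    intro c δ hδ
    refine ⟨fun x y => ?_, fun x => by simp [hδ.map_star], fun x y h => ?_⟩
    · simp [hδ.leibniz, smul_add]
    · rw [LinearMap.smul_apply, LinearMap.smul_apply, hδ.evenOdd_comm x y h,
        ← Complex.coe_smul c, ← Complex.coe_smul c, map_smul]

/-- The relation between a potential `Φ` and a derivation `δ`: for every finite `I` the limit
`H(I) = lim_{J ↗ Λ} ∑ {Φ(K) ; K ∩ I ≠ ∅, K ⊆ J}` exists in norm, and `δ x = i [H(I), x]` for all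
`x ∈ 𝒜(I)`. (For finite `I`, `𝒜(I) ⊆ 𝒜_∘`.) -/
def Generates [DecidableEq Λ] (a : Λ → A) (Φ : Finset Λ → A)
    (δ : strictlyLocal a →ₗ[ℂ] A) : Prop :=
  ∀ I : Finset Λ, ∃ H : A,
    Tendsto (fun J : Finset Λ => partialHamiltonian Φ I J) atTop (𝓝 H) ∧
    ∀ x : strictlyLocal a, (x : A) ∈ localAlgebra a (I : Set Λ) →
      δ x = Complex.I • (H * (x : A) - (x : A) * H)

end FermionLattice

end

/-! Potentials and derivations carry the same information because both are encoded by local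
Hamiltonians H(I) normalized by E_{Iᶜ} H(I) = 0.

From a derivation to Hamiltonians: δ is made inner on a finite region by correcting the implementing
element one self-adjoint (Majorana) generator at a time (`exists_inner_majorana`), and E_{Iᶜ} of the
result is then subtracted (`exists_hamiltonian`). An even element commuting with 𝒜(I) lies in 𝒜(Iᶜ),
so the even normalized H(I) is unique (`eq_of_commutator_eq`).

From Hamiltonians to a potential: Φ(K) is the Möbius component ∑_{L ⊆ K} (-1)^{|K|-|L|} E_L H(K). If
i ∈ I ∩ K, then H(I) and H({i}) differ by an element of 𝒜({i}ᶜ), which has no K-component; if I ∩ K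
= ∅, the normalization makes the K-component of H(I) vanish. Möbius inversion therefore gives H_J(I)
= E_J H(I), which converges to H(I). Conversely, E_J of the limit Hamiltonian of any standard
potential is H_J(I), so δ determines all H_J(J), and Φ follows by induction on J.

The expectations are built without a representation. The map x ↦ c Θ(x) c changes the sign of the
Majorana generator c alone; averaging it with the identity removes c, and limits of products of
these commuting averages give `expect N`. Its range is the fixed-point algebra of the flips outside
N, whence E_N E_N' = E_{N ∩ N'}. The case N = ∅ gives the tracial state, whose nondegeneracy on
finite regions identifies `expect` with `condExp`. -/

open Filter Topology

noncomputable section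

namespace FermionLattice

variable {Λ : Type*} {A : Type*} [CStarAlgebra A]

/-! ### Majorana generators and the algebras they generate -/

/-- The self-adjoint (Majorana) generators: `a i + (a i)*` and `i (a i - (a i)*)`. -/
def majorana (a : Λ → A) (k : Λ × Bool) : A :=
  if k.2 then a k.1 + star (a k.1) else Complex.I • (a k.1 - star (a k.1))

/-- The algebra generated by the Majorana generators indexed by `N`. -/
def majoranaAlgebra (a : Λ → A) (N : Set (Λ × Bool)) : Subalgebra ℂ A :=
  Algebra.adjoin ℂ (majorana a '' N)

theorem star_majorana (a : Λ → A) (k : Λ × Bool) : star (majorana a k) = majorana a k := by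
  rcases k with ⟨i, _ | _⟩ <;> simp [majorana, add_comm, ← smul_neg]

theorem eq_majorana (a : Λ → A) (i : Λ) :
    a i = (1 / 2 : ℂ) • (majorana a (i, true) - Complex.I • majorana a (i, false)) := by
  simp only [majorana, if_true, Bool.false_eq_true, if_false, smul_smul, Complex.I_mul_I]
  module

theorem star_eq_majorana (a : Λ → A) (i : Λ) :
    star (a i) = (1 / 2 : ℂ) • (majorana a (i, true) + Complex.I • majorana a (i, false)) := by
  simp only [majorana, if_true, Bool.false_eq_true, if_false, smul_smul, Complex.I_mul_I]
  module

theorem adjoin_toSubalgebra_eq (a : Λ → A) (I : Set Λ) :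
    (StarAlgebra.adjoin ℂ (a '' I)).toSubalgebra = majoranaAlgebra a (Prod.fst ⁻¹' I) := by
  rw [StarAlgebra.adjoin_toSubalgebra]
  apply le_antisymm
  · refine Algebra.adjoin_le ?_
    have hm : ∀ i ∈ I, ∀ b, majorana a (i, b) ∈ majoranaAlgebra a (Prod.fst ⁻¹' I) :=
      fun i hi b => Algebra.subset_adjoin ⟨(i, b), hi, rfl⟩
    rintro x (⟨i, hi, rfl⟩ | hx)
    · rw [SetLike.mem_coe, eq_majorana a i]
      exact Subalgebra.smul_mem _ (sub_mem (hm i hi _) (Subalgebra.smul_mem _ (hm i hi _) _)) _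
    · obtain ⟨i, hi, h⟩ := hx
      rw [SetLike.mem_coe, ← star_star x, ← h, star_eq_majorana]
      exact Subalgebra.smul_mem _ (add_mem (hm i hi _) (Subalgebra.smul_mem _ (hm i hi _) _)) _
  · refine Algebra.adjoin_le ?_
    rintro _ ⟨⟨i, b⟩, hi, rfl⟩
    have h1 : a i ∈ Algebra.adjoin ℂ (a '' I ∪ star (a '' I)) :=
      Algebra.subset_adjoin (Or.inl ⟨i, hi, rfl⟩)
    have h2 : star (a i) ∈ Algebra.adjoin ℂ (a '' I ∪ star (a '' I)) :=
      Algebra.subset_adjoin (Or.inr ⟨i, hi, (star_star _).symm⟩)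
    cases b
    · simpa [majorana] using Subalgebra.smul_mem _ (sub_mem h1 h2) Complex.I
    · simpa [majorana] using add_mem h1 h2

theorem mem_adjoin_iff (a : Λ → A) (I : Set Λ) (x : A) :
    x ∈ StarAlgebra.adjoin ℂ (a '' I) ↔ x ∈ majoranaAlgebra a (Prod.fst ⁻¹' I) := by
  rw [← adjoin_toSubalgebra_eq]; rfl

theorem mem_strictlyLocal_iff (a : Λ → A) (x : A) :
    x ∈ strictlyLocal a ↔ x ∈ majoranaAlgebra a Set.univ := by
  rw [strictlyLocal, ← Set.image_univ, mem_adjoin_iff, Set.preimage_univ]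

theorem mem_localAlgebra_iff (a : Λ → A) (I : Set Λ) (x : A) :
    x ∈ localAlgebra a I ↔ x ∈ closure (majoranaAlgebra a (Prod.fst ⁻¹' I) : Set A) := by
  rw [localAlgebra, ← SetLike.mem_coe, StarSubalgebra.topologicalClosure_coe,
    ← adjoin_toSubalgebra_eq]; rfl

theorem majorana_mem (a : Λ → A) {N : Set (Λ × Bool)} {k : Λ × Bool} (hk : k ∈ N) :
    majorana a k ∈ majoranaAlgebra a N :=
  Algebra.subset_adjoin ⟨k, hk, rfl⟩

theorem majoranaAlgebra_mono (a : Λ → A) {N N' : Set (Λ × Bool)} (h : N ⊆ N') :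
    majoranaAlgebra a N ≤ majoranaAlgebra a N' :=
  Algebra.adjoin_mono (Set.image_mono h)

theorem exists_finset_mem (a : Λ → A) {x : A} (hx : x ∈ majoranaAlgebra a Set.univ) :
    ∃ F : Finset (Λ × Bool), x ∈ majoranaAlgebra a (F : Set (Λ × Bool)) := by
  classical
  induction hx using Algebra.adjoin_induction with
  | mem x hx =>
    obtain ⟨k, -, rfl⟩ := hx
    exact ⟨{k}, majorana_mem a (by simp)⟩
  | algebraMap r => exact ⟨∅, Subalgebra.algebraMap_mem _ r⟩
  | add x y _ _ hx hy =>
    obtain ⟨F, hF⟩ := hx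
    obtain ⟨G, hG⟩ := hy
    exact ⟨F ∪ G, add_mem (majoranaAlgebra_mono a (by simp) hF)
      (majoranaAlgebra_mono a (by simp) hG)⟩
  | mul x y _ _ hx hy =>
    obtain ⟨F, hF⟩ := hx
    obtain ⟨G, hG⟩ := hy
    exact ⟨F ∪ G, mul_mem (majoranaAlgebra_mono a (by simp) hF)
      (majoranaAlgebra_mono a (by simp) hG)⟩

/-- Two algebra homomorphisms agreeing on generators agree on the generated algebra. -/
theorem eq_on_majoranaAlgebra {a : Λ → A} {N : Set (Λ × Bool)} (f g : A →ₐ[ℂ] A)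
    (h : ∀ k ∈ N, f (majorana a k) = g (majorana a k)) {x : A} (hx : x ∈ majoranaAlgebra a N) :
    f x = g x := by
  have : majoranaAlgebra a N ≤ AlgHom.equalizer f g := by
    refine Algebra.adjoin_le ?_
    rintro _ ⟨k, hk, rfl⟩
    exact h k hk
  exact this hx

/-- Pointwise limit of a uniformly contractive net of linear maps that converges on a
dense set. -/
theorem exists_limit_linearMap {ι : Type*} [Nonempty ι] [SemilatticeSup ι] (T : ι → A →ₗ[ℂ] A)
    (hT : ∀ i x, ‖T i x‖ ≤ ‖x‖) (D : Set A) (hD : Dense D)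
    (h : ∀ x ∈ D, ∃ y, Tendsto (fun i => T i x) atTop (𝓝 y)) :
    ∃ E : A →ₗ[ℂ] A, ∀ x, Tendsto (fun i => T i x) atTop (𝓝 (E x)) := by
  have key : ∀ x, ∃ y, Tendsto (fun i => T i x) atTop (𝓝 y) := by
    intro x
    apply cauchySeq_tendsto_of_complete
    rw [Metric.cauchySeq_iff']
    intro ε hε
    obtain ⟨y, hy, hxy⟩ := Metric.dense_iff.1 hD x (ε / 3) (by positivity)
    obtain ⟨z, hz⟩ := h _ hxy
    obtain ⟨N, hN⟩ := Metric.cauchySeq_iff'.1 hz.cauchySeq (ε / 3) (by positivity)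
    refine ⟨N, fun n hn => ?_⟩
    have h1 : ∀ m, dist (T m x) (T m y) < ε / 3 := fun m => by
      rw [dist_eq_norm, ← map_sub]
      refine (hT m _).trans_lt ?_
      rwa [Metric.mem_ball, dist_comm, dist_eq_norm] at hy
    calc dist (T n x) (T N x)
        ≤ dist (T n x) (T n y) + dist (T n y) (T N y) + dist (T N y) (T N x) :=
          dist_triangle4 _ _ _ _
      _ < ε / 3 + ε / 3 + ε / 3 := by
          have := h1 N
          rw [dist_comm] at this
          exact add_lt_add (add_lt_add (h1 n) (hN n hn)) this
      _ = ε := by ring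
  choose E hE using key
  exact ⟨{ toFun := E
           map_add' := fun x y => tendsto_nhds_unique (hE (x + y)) (by
            simpa only [map_add] using (hE x).add (hE y))
           map_smul' := fun c x => tendsto_nhds_unique (hE (c • x)) (by
            simpa only [map_smul, RingHom.id_apply] using (hE x).const_smul c) }, hE⟩

theorem continuous_evenOdd (a : Λ → A) : Continuous (evenOdd a) :=
  (StarAlgEquiv.isometry (evenOdd a)).continuous

theorem map_majorana_neg {a : Λ → A} {θ : A ≃⋆ₐ[ℂ] A} (h : ∀ i, θ (a i) = -a i) (k : Λ × Bool) :
    θ (majorana a k) = -majorana a k := by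
  rcases k with ⟨i, _ | _⟩
  · simp only [majorana, Bool.false_eq_true, if_false, map_smul, map_sub, map_star, h]
    rw [← smul_neg]; congr 1; simp; abel
  · simp [majorana, map_star, h]; abel

/-! ### Anticommutation relations and the even-oddness automorphism -/

section CAR
variable [DecidableEq Λ] {a : Λ → A} (ha : IsFermionAlgebra a)
include ha

theorem IsFermionAlgebra.sq_eq_zero (i : Λ) : a i * a i = 0 := by
  have h := ha.mul_add_mul i i
  rw [← two_smul ℂ] at h
  simpa using h

theorem IsFermionAlgebra.star_sq_eq_zero (i : Λ) : star (a i) * star (a i) = 0 := by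
  rw [← star_mul, ha.sq_eq_zero, star_zero]

theorem IsFermionAlgebra.majorana_mul_self (k : Λ × Bool) :
    majorana a k * majorana a k = 1 := by
  have h1 := ha.sq_eq_zero k.1
  have h2 := ha.star_sq_eq_zero k.1
  have h3 := ha.star_mul_add_mul_star k.1 k.1
  rw [if_pos rfl] at h3
  rcases k with ⟨i, _ | _⟩
  · simp only [majorana, Bool.false_eq_true, if_false, smul_mul_smul_comm, Complex.I_mul_I,
      sub_mul, mul_sub, h1, h2, ← h3]
    simp [add_comm]
  · simp [majorana, add_mul, mul_add, h1, h2, ← h3]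

theorem IsFermionAlgebra.majorana_anticomm {k l : Λ × Bool} (h : k ≠ l) :
    majorana a k * majorana a l = -(majorana a l * majorana a k) := by
  rcases k with ⟨i, b⟩
  rcases l with ⟨j, b'⟩
  by_cases hij : i = j
  · subst hij
    have h1 := ha.sq_eq_zero i
    have h2 := ha.star_sq_eq_zero i
    cases b <;> cases b' <;> simp [majorana, add_mul, mul_add, sub_mul, mul_sub, smul_sub,
      h1, h2] at h ⊢
    all_goals abel
  · have h1 := eq_neg_of_add_eq_zero_left (ha.mul_add_mul i j)
    have h2 := eq_neg_of_add_eq_zero_left (ha.star_mul_star_add i j)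
    have h3 := ha.star_mul_add_mul_star i j
    have h4 := ha.star_mul_add_mul_star j i
    rw [if_neg hij] at h3
    rw [if_neg (Ne.symm hij)] at h4
    replace h3 := eq_neg_of_add_eq_zero_left h3
    replace h4 := eq_neg_of_add_eq_zero_right h4
    cases b <;> cases b' <;>
      simp only [majorana, if_true, Bool.false_eq_true, if_false, add_mul, mul_add, sub_mul,
        mul_sub, smul_mul_assoc, mul_smul_comm, h1, h2, h3, h4] <;> module

theorem IsFermionAlgebra.dense : Dense (majoranaAlgebra a Set.univ : Set A) := by
  have h : (majoranaAlgebra a Set.univ : Set A) = StarAlgebra.adjoin ℂ (Set.range a) := by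
    ext x; exact (mem_strictlyLocal_iff a x).symm
  rw [h, dense_iff_closure_eq, ← StarSubalgebra.topologicalClosure_coe, ha.generates]
  rfl

/-- The product of the two Majorana generators at a site is a unitary that anticommutes with both of
them and, being a product of two, commutes with all generators at other sites. Multiplying over the
sites of `J` gives `u`. -/
theorem IsFermionAlgebra.exists_unitary_flip (J : Finset Λ) : ∃ u : unitary A, ∀ k : Λ × Bool,
    (u : A) * majorana a k * star (u : A) =
      if k.1 ∈ J then -majorana a k else majorana a k := by
  induction J using Finset.induction_on with
  | empty => exact ⟨1, fun k => by simp⟩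
  | insert j J hj ih =>
    obtain ⟨u, hu⟩ := ih
    have hs : ∀ k, majorana a k * majorana a k = 1 := ha.majorana_mul_self
    have hs' : ∀ k x, majorana a k * (majorana a k * x) = x := fun k x => by
      rw [← mul_assoc, hs, one_mul]
    let w : unitary A := ⟨majorana a (j, true) * majorana a (j, false), by
      rw [Unitary.mem_iff]
      simp only [star_mul, star_majorana, mul_assoc, hs', hs, and_self]⟩
    have hw : ∀ k : Λ × Bool, (w : A) * majorana a k * star (w : A) =
        if k.1 = j then -majorana a k else majorana a k := by
      intro k
      change majorana a (j, true) * majorana a (j, false) * majorana a k *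
        star (majorana a (j, true) * majorana a (j, false)) = _
      rw [star_mul, star_majorana, star_majorana]
      have key : ∀ l, l ≠ k → ∀ x, majorana a l * (majorana a k * x) =
          -(majorana a k * (majorana a l * x)) := fun l hl x => by
        rw [← mul_assoc, ha.majorana_anticomm hl, neg_mul, mul_assoc]
      simp only [mul_assoc]
      by_cases hk : k.1 = j
      · rw [if_pos hk]
        rcases k with ⟨i, b⟩
        simp only at hk
        subst hk
        cases b
        · rw [hs', ha.majorana_anticomm (k := (i, false)) (l := (i, true)) (by simp), mul_neg, hs']
        · rw [key (i, false) (by simp)]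
          simp [hs, hs']
      · rw [if_neg hk]
        rw [key _ (by rintro rfl; exact hk rfl), mul_neg, key _ (by rintro rfl; exact hk rfl)]
        simp [hs, hs']
    refine ⟨u * w, fun k => ?_⟩
    have : ((u * w : unitary A) : A) * majorana a k * star ((u * w : unitary A) : A) =
        (u : A) * ((w : A) * majorana a k * star (w : A)) * star (u : A) := by
      simp [mul_assoc]
    rw [this, hw]
    by_cases hk : k.1 = j
    · simp [hk, hu, hj]
    · simp [hk, hu]

/-- `evenOdd` is a choice, so its property needs existence. Θ is the pointwise limit of the inner
automorphisms flipping finite regions: they are isometric, and eventually constant on each element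
of a dense algebra. -/
theorem IsFermionAlgebra.exists_evenOdd : ∃ θ : A ≃⋆ₐ[ℂ] A, ∀ i, θ (a i) = -a i := by
  choose u hu using ha.exists_unitary_flip
  let T : Finset Λ → A ≃⋆ₐ[ℂ] A := fun J => Unitary.conjStarAlgAut ℂ A (u J)
  have hT : ∀ J k, T J (majorana a k) = if k.1 ∈ J then -majorana a k else majorana a k := hu
  have hev : ∀ J J' : Finset Λ, J ⊆ J' → ∀ x ∈ majoranaAlgebra a (Prod.fst ⁻¹' (J : Set Λ)),
      T J' x = T J x := fun J J' h x hx =>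
    eq_on_majoranaAlgebra (T J' : A →⋆ₐ[ℂ] A).toAlgHom (T J : A →⋆ₐ[ℂ] A).toAlgHom
      (fun k hk => by
        change T J' _ = T J _
        rw [hT, hT, if_pos (h hk), if_pos (show k.1 ∈ J from hk)]) hx
  have hfin : ∀ x ∈ majoranaAlgebra a Set.univ, ∃ J : Finset Λ,
      x ∈ majoranaAlgebra a (Prod.fst ⁻¹' (J : Set Λ)) := fun x hx => by
    obtain ⟨F, hF⟩ := exists_finset_mem a hx
    exact ⟨F.image Prod.fst, majoranaAlgebra_mono a
      (fun k hk => by simpa using Finset.mem_image_of_mem Prod.fst hk) hF⟩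
  obtain ⟨E, hE⟩ := exists_limit_linearMap (A := A)
    (fun J => ((T J : A →⋆ₐ[ℂ] A) : A →ₗ[ℂ] A))
    (fun J x => (StarAlgEquiv.norm_map (T J) x).le) _ ha.dense (fun x hx => by
      obtain ⟨J, hJ⟩ := hfin x hx
      exact ⟨T J x, tendsto_const_nhds.congr' (by
        filter_upwards [eventually_ge_atTop J] with J' h using (hev J J' h x hJ).symm)⟩)
  replace hE : ∀ x, Tendsto (fun J => T J x) atTop (𝓝 (E x)) := hE
  have hmaj : ∀ k, E (majorana a k) = -majorana a k := fun k =>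
    tendsto_nhds_unique (hE _) (tendsto_const_nhds.congr' (by
      filter_upwards [eventually_ge_atTop {k.1}] with J h
      rw [hT, if_pos (by simpa using h)]))
  have hmul : ∀ x y, E (x * y) = E x * E y := fun x y =>
    tendsto_nhds_unique (hE _) (by simpa only [map_mul] using (hE x).mul (hE y))
  have hstar : ∀ x, E (star x) = star (E x) := fun x =>
    tendsto_nhds_unique (hE _) (by simpa only [map_star] using (hE x).star)
  have hone : E 1 = 1 :=
    tendsto_nhds_unique (hE _) (by simp)
  have hnorm : ∀ x, ‖E x‖ = ‖x‖ := fun x =>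
    tendsto_nhds_unique (hE x).norm (by simp only [StarAlgEquiv.norm_map]; exact tendsto_const_nhds)
  have hcont : Continuous E := AddMonoidHomClass.continuous_of_bound E 1 (fun x => by simp [hnorm])
  let f : A →ₐ[ℂ] A := AlgHom.ofLinearMap E hone hmul
  have hinv : ∀ x, E (E x) = x := by
    intro x
    refine congrFun (Continuous.ext_on ha.dense (hcont.comp hcont) continuous_id ?_) x
    intro y hy
    exact eq_on_majoranaAlgebra (f.comp f) (AlgHom.id ℂ A) (fun k _ => by
      change E (E _) = _
      rw [hmaj, map_neg, hmaj, neg_neg]; rfl) hy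
  -- The limit is an involution, which supplies bijectivity.
  refine ⟨{ toFun := E, invFun := E, left_inv := hinv, right_inv := hinv, map_mul' := hmul,
            map_add' := map_add E, map_star' := hstar, map_smul' := map_smul E }, fun i => ?_⟩
  change E (a i) = - a i
  conv_lhs => rw [eq_majorana a i]
  rw [map_smul, map_sub, map_smul, hmaj, hmaj]
  conv_rhs => rw [eq_majorana a i]
  module

theorem IsFermionAlgebra.evenOdd_apply (i : Λ) : evenOdd a (a i) = -a i :=
  Classical.epsilon_spec ha.exists_evenOdd i

theorem IsFermionAlgebra.evenOdd_majorana (k : Λ × Bool) :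
    evenOdd a (majorana a k) = -majorana a k :=
  map_majorana_neg ha.evenOdd_apply k

theorem IsFermionAlgebra.evenOdd_evenOdd (x : A) : evenOdd a (evenOdd a x) = x := by
  refine congrFun (Continuous.ext_on ha.dense
    ((continuous_evenOdd a).comp (continuous_evenOdd a)) continuous_id ?_) x
  intro y hy
  let f : A →ₐ[ℂ] A := (evenOdd a : A →⋆ₐ[ℂ] A).toAlgHom
  exact eq_on_majoranaAlgebra (f.comp f) (AlgHom.id ℂ A) (fun k _ => by
    change evenOdd a (evenOdd a _) = majorana a k
    rw [ha.evenOdd_majorana, map_neg, ha.evenOdd_majorana, neg_neg]) hy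

/-- A continuous linear functional invariant under unitary conjugation is `Θ`-invariant. -/
theorem IsFermionAlgebra.map_evenOdd {τ : A →ₗ[ℂ] ℂ} (hc : Continuous τ)
    (hτ : ∀ x y, τ (x * y) = τ (y * x)) (x : A) : τ (evenOdd a x) = τ x := by
  refine congrFun (Continuous.ext_on ha.dense (hc.comp (continuous_evenOdd a)) hc ?_) x
  intro y hy
  obtain ⟨F, hF⟩ := exists_finset_mem a hy
  -- On finitely many generators Θ is inner, so traciality applies.
  obtain ⟨u, hu⟩ := ha.exists_unitary_flip (F.image Prod.fst)
  have : evenOdd a y = u * y * star (u : A) :=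
    eq_on_majoranaAlgebra (evenOdd a : A →⋆ₐ[ℂ] A).toAlgHom
      ((Unitary.conjStarAlgAut ℂ A u : A ≃⋆ₐ[ℂ] A) : A →⋆ₐ[ℂ] A).toAlgHom (fun k hk => by
        change evenOdd a _ = u * majorana a k * star (u : A)
        rw [hu, ha.evenOdd_majorana, if_pos (Finset.mem_image_of_mem _ hk)]) hF
  change τ (evenOdd a y) = τ y
  rw [this, hτ, ← mul_assoc, Unitary.coe_star_mul_self, one_mul]

end CAR

/-! ### Flips and averages over a single generator -/

/-- The map `x ↦ c Θ(x) c`, which flips the sign of the Majorana generator `c` only. -/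
def flip (a : Λ → A) (k : Λ × Bool) : A →ₗ[ℂ] A where
  toFun x := majorana a k * evenOdd a x * majorana a k
  map_add' x y := by simp [mul_add, add_mul]
  map_smul' c x := by simp

/-- The average of the identity and `flip a k`. -/
def avg (a : Λ → A) (k : Λ × Bool) : Module.End ℂ A := (1 / 2 : ℂ) • (1 + flip a k)

theorem flip_apply (a : Λ → A) (k : Λ × Bool) (x : A) :
    flip a k x = majorana a k * evenOdd a x * majorana a k := rfl

theorem avg_apply (a : Λ → A) (k : Λ × Bool) (x : A) :
    avg a k x = (1 / 2 : ℂ) • (x + flip a k x) := rfl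

theorem star_flip (a : Λ → A) (k : Λ × Bool) (x : A) : star (flip a k x) = flip a k (star x) := by
  simp [flip_apply, star_majorana, map_star, mul_assoc]

theorem star_avg (a : Λ → A) (k : Λ × Bool) (x : A) : star (avg a k x) = avg a k (star x) := by
  simp [avg_apply, star_flip]

theorem continuous_flip (a : Λ → A) (k : Λ × Bool) : Continuous (flip a k) :=
  (continuous_const.mul (continuous_evenOdd a)).mul continuous_const

theorem continuous_avg (a : Λ → A) (k : Λ × Bool) : Continuous (avg a k) :=
  (continuous_id.add (continuous_flip a k)).const_smul (1 / 2 : ℂ)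

theorem avg_eq_self_iff {a : Λ → A} {k : Λ × Bool} {x : A} : avg a k x = x ↔ flip a k x = x := by
  rw [avg_apply]
  constructor
  · intro h
    have : flip a k x = (2 : ℂ) • ((1 / 2 : ℂ) • (x + flip a k x)) - x := by module
    rw [this, h]; module
  · intro h
    rw [h]; module

section CAR
variable [DecidableEq Λ] {a : Λ → A} (ha : IsFermionAlgebra a)
include ha

theorem IsFermionAlgebra.majorana_mul_cancel (k : Λ × Bool) (x : A) :
    majorana a k * (majorana a k * x) = x := by
  rw [← mul_assoc, ha.majorana_mul_self, one_mul]

theorem IsFermionAlgebra.flip_mul (k : Λ × Bool) (x y : A) :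
    flip a k (x * y) = flip a k x * flip a k y := by
  simp only [flip_apply, map_mul, mul_assoc, ha.majorana_mul_cancel]

theorem IsFermionAlgebra.flip_one (k : Λ × Bool) : flip a k 1 = 1 := by
  simp [flip_apply, ha.majorana_mul_self]

/-- `flip a k` as a homomorphism. -/
def IsFermionAlgebra.flipHom (k : Λ × Bool) : A →⋆ₐ[ℂ] A where
  toFun := flip a k
  map_one' := ha.flip_one k
  map_mul' := ha.flip_mul k
  map_zero' := map_zero _
  map_add' := map_add _
  commutes' r := by rw [Algebra.algebraMap_eq_smul_one, map_smul, ha.flip_one]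
  map_star' x := (star_flip a k x).symm

theorem IsFermionAlgebra.norm_flip_le (k : Λ × Bool) (x : A) : ‖flip a k x‖ ≤ ‖x‖ :=
  NonUnitalStarAlgHom.norm_apply_le (ha.flipHom k) x

theorem IsFermionAlgebra.flip_flip (k : Λ × Bool) (x : A) : flip a k (flip a k x) = x := by
  simp only [flip_apply, map_mul, ha.evenOdd_evenOdd, ha.evenOdd_majorana, neg_mul, mul_neg,
    neg_neg, mul_assoc, ha.majorana_mul_cancel, ha.majorana_mul_self, mul_one]

theorem IsFermionAlgebra.flip_comm (k l : Λ × Bool) (x : A) :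
    flip a k (flip a l x) = flip a l (flip a k x) := by
  by_cases h : k = l
  · rw [h]
  · simp only [flip_apply, map_mul, ha.evenOdd_evenOdd, ha.evenOdd_majorana, neg_mul, mul_neg,
      neg_neg]
    calc majorana a k * (majorana a l * x * majorana a l) * majorana a k
        = majorana a k * majorana a l * x * (majorana a l * majorana a k) := by
          simp only [mul_assoc]
      _ = -(majorana a l * majorana a k) * x * -(majorana a k * majorana a l) := by
          rw [← ha.majorana_anticomm h, ← ha.majorana_anticomm (Ne.symm h)]
      _ = majorana a l * (majorana a k * x * majorana a k) * majorana a l := by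
          simp only [neg_mul, mul_neg, neg_neg, mul_assoc]

theorem IsFermionAlgebra.flip_evenOdd (k : Λ × Bool) (x : A) :
    flip a k (evenOdd a x) = evenOdd a (flip a k x) := by
  simp [flip_apply, ha.evenOdd_majorana]

theorem IsFermionAlgebra.flip_majorana_self (k : Λ × Bool) :
    flip a k (majorana a k) = -majorana a k := by
  simp [flip_apply, ha.evenOdd_majorana, ha.majorana_mul_self]

theorem IsFermionAlgebra.flip_majorana_ne {k l : Λ × Bool} (h : k ≠ l) :
    flip a k (majorana a l) = majorana a l := by
  rw [flip_apply, ha.evenOdd_majorana, mul_neg, ← ha.majorana_anticomm h.symm, mul_assoc,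
    ha.majorana_mul_self, mul_one]

theorem IsFermionAlgebra.flip_eq_self_of_mem {k : Λ × Bool} {N : Set (Λ × Bool)} (hk : k ∉ N)
    {x : A} (hx : x ∈ closure (majoranaAlgebra a N : Set A)) : flip a k x = x := by
  refine closure_minimal (fun y hy => ?_)
    (isClosed_eq (continuous_flip a k) continuous_id) hx
  exact eq_on_majoranaAlgebra (ha.flipHom k).toAlgHom (AlgHom.id ℂ A)
    (fun l hl => ha.flip_majorana_ne (by rintro rfl; exact hk hl)) hy

theorem IsFermionAlgebra.avg_avg (k : Λ × Bool) (x : A) : avg a k (avg a k x) = avg a k x := by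
  simp only [avg_apply, map_smul, map_add, ha.flip_flip]
  module

theorem IsFermionAlgebra.flip_avg_self (k : Λ × Bool) (x : A) :
    flip a k (avg a k x) = avg a k x :=
  avg_eq_self_iff.1 (ha.avg_avg k x)

theorem IsFermionAlgebra.flip_avg (k l : Λ × Bool) (x : A) :
    flip a k (avg a l x) = avg a l (flip a k x) := by
  simp only [avg_apply, map_smul, map_add, ha.flip_comm k l]

theorem IsFermionAlgebra.avg_commute (k l : Λ × Bool) : Commute (avg a k) (avg a l) := by
  refine LinearMap.ext fun x => ?_
  change avg a k (avg a l x) = avg a l (avg a k x)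
  rw [avg_apply a k, avg_apply a k, ha.flip_avg, map_smul, map_add]

theorem IsFermionAlgebra.avg_evenOdd (k : Λ × Bool) (x : A) :
    avg a k (evenOdd a x) = evenOdd a (avg a k x) := by
  simp [avg_apply, ha.flip_evenOdd]

theorem IsFermionAlgebra.avg_mul_left {k : Λ × Bool} {b : A} (hb : flip a k b = b) (x : A) :
    avg a k (b * x) = b * avg a k x := by
  simp [avg_apply, ha.flip_mul, hb, mul_add]

theorem IsFermionAlgebra.avg_mul_right {k : Λ × Bool} {b : A} (hb : flip a k b = b) (x : A) :
    avg a k (x * b) = avg a k x * b := by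
  simp [avg_apply, ha.flip_mul, hb, add_mul]

theorem IsFermionAlgebra.norm_avg_le (k : Λ × Bool) (x : A) : ‖avg a k x‖ ≤ ‖x‖ := by
  rw [avg_apply, norm_smul]
  have h1 := norm_add_le x (flip a k x)
  have h2 := ha.norm_flip_le k x
  norm_num
  linarith

/-- This splits `x` into its parts even and odd under `flip a k`: the second summand equals `(x -
flip a k x) / 2`. It drives the nondegeneracy induction for the trace. -/
theorem IsFermionAlgebra.eq_avg_add (k : Λ × Bool) (x : A) :
    x = avg a k x + majorana a k * avg a k (majorana a k * x) := by
  simp only [avg_apply, ha.flip_mul, ha.flip_majorana_self, mul_smul_comm, mul_add,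
    neg_mul, mul_neg, ha.majorana_mul_cancel]
  module

theorem IsFermionAlgebra.avg_majorana_self (k : Λ × Bool) : avg a k (majorana a k) = 0 := by
  simp [avg_apply, ha.flip_majorana_self]

theorem IsFermionAlgebra.avg_one (k : Λ × Bool) : avg a k 1 = 1 :=
  avg_eq_self_iff.2 (ha.flip_one k)

/-- Averaging over the generator `k` removes it from the algebra. -/
theorem IsFermionAlgebra.avg_mem {k : Λ × Bool} {N : Set (Λ × Bool)} (hk : k ∉ N) {x : A}
    (hx : x ∈ majoranaAlgebra a (insert k N)) :
    avg a k x ∈ majoranaAlgebra a N ∧ avg a k (majorana a k * x) ∈ majoranaAlgebra a N := by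
  -- The average of a product is not controlled by the averages of its factors. The induction
  -- instead shows that left multiplication by `x` preserves the set of `y` whose two components
  -- avoid the generator `k`.
  suffices h : ∀ y, (avg a k y ∈ majoranaAlgebra a N ∧
      avg a k (majorana a k * y) ∈ majoranaAlgebra a N) →
      (avg a k (x * y) ∈ majoranaAlgebra a N ∧
      avg a k (majorana a k * (x * y)) ∈ majoranaAlgebra a N) by
    simpa using h 1 (by
      rw [mul_one, ha.avg_one, ha.avg_majorana_self]
      exact ⟨one_mem _, zero_mem _⟩)
  induction hx using Algebra.adjoin_induction with
  | mem x hx =>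
    rintro y ⟨h1, h2⟩
    obtain ⟨l, hl, rfl⟩ := hx
    rcases hl with rfl | hl
    · exact ⟨h2, by rwa [ha.majorana_mul_cancel]⟩
    · have hne : k ≠ l := by rintro rfl; exact hk hl
      have hf := ha.flip_majorana_ne hne
      have hm : majorana a l ∈ majoranaAlgebra a N := majorana_mem a hl
      rw [ha.avg_mul_left hf, ← mul_assoc, ha.majorana_anticomm hne, neg_mul, map_neg, mul_assoc,
        ha.avg_mul_left hf]
      exact ⟨mul_mem hm h1, neg_mem (mul_mem hm h2)⟩
  | algebraMap r =>
    rintro y ⟨h1, h2⟩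
    rw [Algebra.algebraMap_eq_smul_one, smul_mul_assoc, one_mul, mul_smul_comm, map_smul, map_smul]
    exact ⟨Subalgebra.smul_mem _ h1 _, Subalgebra.smul_mem _ h2 _⟩
  | add x z _ _ hx hz =>
    intro y hy
    rw [add_mul, mul_add, map_add, map_add]
    exact ⟨add_mem (hx y hy).1 (hz y hy).1, add_mem (hx y hy).2 (hz y hy).2⟩
  | mul x z _ _ hx hz =>
    intro y hy
    rw [mul_assoc]
    exact hx _ (hz y hy)

/-! ### Conditional expectations as limits of products of averages -/

/-- The product of the averages over the generators in `F`. -/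
def IsFermionAlgebra.avgProd (F : Finset (Λ × Bool)) : Module.End ℂ A :=
  F.noncommProd (avg a) fun k _ l _ _ => ha.avg_commute k l

theorem IsFermionAlgebra.avgProd_empty (x : A) : ha.avgProd ∅ x = x := rfl

theorem IsFermionAlgebra.avgProd_insert {F : Finset (Λ × Bool)} {k : Λ × Bool} (hk : k ∉ F)
    (x : A) : ha.avgProd (insert k F) x = avg a k (ha.avgProd F x) := by
  exact LinearMap.congr_fun (Finset.noncommProd_insert_of_notMem F k (avg a) _ hk) x

theorem IsFermionAlgebra.avgProd_union {F G : Finset (Λ × Bool)} (h : Disjoint F G) (x : A) :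
    ha.avgProd (F ∪ G) x = ha.avgProd F (ha.avgProd G x) := by
  exact LinearMap.congr_fun (Finset.noncommProd_union_of_disjoint h (avg a) _) x

theorem IsFermionAlgebra.avg_avgProd (F : Finset (Λ × Bool)) (k : Λ × Bool) (x : A) :
    avg a k (ha.avgProd F x) = ha.avgProd F (avg a k x) :=
  LinearMap.congr_fun
    (Finset.noncommProd_commute F (avg a) _ (avg a k) fun l _ => ha.avg_commute k l).eq x

/-- A property preserved by the averages is preserved by their products. -/
theorem IsFermionAlgebra.avgProd_induction (F : Finset (Λ × Bool)) (p : A → Prop)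
    (h : ∀ k ∈ F, ∀ x, p x → p (avg a k x)) {x : A} (hx : p x) : p (ha.avgProd F x) := by
  induction F using Finset.induction_on with
  | empty => exact hx
  | insert k F hk ih =>
    rw [ha.avgProd_insert hk]
    exact h k (Finset.mem_insert_self _ _) _ (ih fun l hl => h l (Finset.mem_insert_of_mem hl))

theorem IsFermionAlgebra.norm_avgProd_le (F : Finset (Λ × Bool)) (x : A) :
    ‖ha.avgProd F x‖ ≤ ‖x‖ :=
  ha.avgProd_induction F (fun y => ‖y‖ ≤ ‖x‖) (fun k _ y hy => (ha.norm_avg_le k y).trans hy) le_rfl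

theorem IsFermionAlgebra.avgProd_eq_self {F : Finset (Λ × Bool)} {x : A}
    (h : ∀ k ∈ F, flip a k x = x) : ha.avgProd F x = x :=
  ha.avgProd_induction F (· = x) (fun k hk y hy => by rw [hy]; exact avg_eq_self_iff.2 (h k hk)) rfl

theorem IsFermionAlgebra.avgProd_mul_right {F : Finset (Λ × Bool)} {b : A}
    (hb : ∀ k ∈ F, flip a k b = b) (x : A) : ha.avgProd F (x * b) = ha.avgProd F x * b := by
  induction F using Finset.induction_on with
  | empty => rfl
  | insert k F hk ih =>
    rw [ha.avgProd_insert hk, ha.avgProd_insert hk,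
      ih fun l hl => hb l (Finset.mem_insert_of_mem hl),
      ha.avg_mul_right (hb k (Finset.mem_insert_self _ _))]

theorem IsFermionAlgebra.star_avgProd (F : Finset (Λ × Bool)) (x : A) :
    star (ha.avgProd F x) = ha.avgProd F (star x) := by
  induction F using Finset.induction_on with
  | empty => rfl
  | insert k F hk ih => rw [ha.avgProd_insert hk, ha.avgProd_insert hk, star_avg, ih]

theorem IsFermionAlgebra.avgProd_evenOdd (F : Finset (Λ × Bool)) (x : A) :
    ha.avgProd F (evenOdd a x) = evenOdd a (ha.avgProd F x) := by
  induction F using Finset.induction_on with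
  | empty => rfl
  | insert k F hk ih => rw [ha.avgProd_insert hk, ha.avgProd_insert hk, ih, ha.avg_evenOdd]

theorem IsFermionAlgebra.avgProd_mem {F : Finset (Λ × Bool)} {N : Set (Λ × Bool)}
    (h : ∀ k ∈ F, k ∉ N) {x : A} (hx : x ∈ majoranaAlgebra a (F ∪ N)) :
    ha.avgProd F x ∈ majoranaAlgebra a N := by
  induction F using Finset.induction_on generalizing x with
  | empty => simpa [ha.avgProd_empty] using hx
  | insert k F hk ih =>
    rw [ha.avgProd_insert hk, ha.avg_avgProd]
    refine ih (fun l hl => h l (Finset.mem_insert_of_mem hl)) (ha.avg_mem ?_ ?_).1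
    · rintro (h1 | h1)
      · exact hk h1
      · exact h k (Finset.mem_insert_self _ _) h1
    · rwa [Finset.coe_insert, Set.insert_union] at hx

-- Averages over generators that do not occur in `x` act trivially, so the net of products is
-- eventually constant on the dense algebra. Hence the limit defining `expect` exists.
open Classical in
theorem IsFermionAlgebra.avgProd_filter_eq (N : Set (Λ × Bool)) {F G : Finset (Λ × Bool)}
    (h : F ⊆ G) {x : A} (hx : x ∈ majoranaAlgebra a (F : Set (Λ × Bool))) :
    ha.avgProd (G.filter (· ∉ N)) x = ha.avgProd (F.filter (· ∉ N)) x := by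
  have hd : G.filter (· ∉ N) = F.filter (· ∉ N) ∪ (G \ F).filter (· ∉ N) := by
    rw [← Finset.filter_union, Finset.union_sdiff_of_subset h]
  rw [hd, ha.avgProd_union]
  · rw [ha.avgProd_eq_self (F := (G \ F).filter (· ∉ N)) (x := x)]
    intro k hk
    refine ha.flip_eq_self_of_mem ?_ (subset_closure hx)
    simp only [Finset.mem_filter, Finset.mem_sdiff] at hk
    exact hk.1.2
  · exact Finset.disjoint_filter_filter Finset.disjoint_sdiff

open Classical in
theorem IsFermionAlgebra.exists_expect (N : Set (Λ × Bool)) : ∃ E : A →ₗ[ℂ] A, ∀ x,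
    Tendsto (fun F : Finset (Λ × Bool) => ha.avgProd (F.filter (· ∉ N)) x) atTop (𝓝 (E x)) :=
  exists_limit_linearMap (fun F : Finset (Λ × Bool) => ha.avgProd (F.filter (· ∉ N)))
    (fun _ x => ha.norm_avgProd_le _ x) _ ha.dense fun x hx => by
      obtain ⟨F, hF⟩ := exists_finset_mem a hx
      exact ⟨_, tendsto_const_nhds.congr' (by
        filter_upwards [eventually_ge_atTop F] with G h
          using (ha.avgProd_filter_eq N h hF).symm)⟩

/-- The conditional expectation onto the closed algebra generated by the Majorana generators
in `N`. -/
def IsFermionAlgebra.expect (N : Set (Λ × Bool)) : A →ₗ[ℂ] A := (ha.exists_expect N).choose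

open Classical in
theorem IsFermionAlgebra.tendsto_expect (N : Set (Λ × Bool)) (x : A) :
    Tendsto (fun F : Finset (Λ × Bool) => ha.avgProd (F.filter (· ∉ N)) x) atTop
      (𝓝 (ha.expect N x)) :=
  (ha.exists_expect N).choose_spec x

theorem IsFermionAlgebra.norm_expect_le (N : Set (Λ × Bool)) (x : A) : ‖ha.expect N x‖ ≤ ‖x‖ :=
  le_of_tendsto (ha.tendsto_expect N x).norm (Eventually.of_forall fun _ => ha.norm_avgProd_le _ x)

theorem IsFermionAlgebra.continuous_expect (N : Set (Λ × Bool)) : Continuous (ha.expect N) :=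
  AddMonoidHomClass.continuous_of_bound _ 1 fun x => by simpa using ha.norm_expect_le N x

open Classical in
theorem IsFermionAlgebra.expect_eq_avgProd (N : Set (Λ × Bool)) {F : Finset (Λ × Bool)} {x : A}
    (hx : x ∈ majoranaAlgebra a (F : Set (Λ × Bool))) :
    ha.expect N x = ha.avgProd (F.filter (· ∉ N)) x :=
  tendsto_nhds_unique (ha.tendsto_expect N x) (tendsto_const_nhds.congr' (by
    filter_upwards [eventually_ge_atTop F] with G h using (ha.avgProd_filter_eq N h hx).symm))

theorem IsFermionAlgebra.expect_mem_of_mem (N : Set (Λ × Bool)) {x : A}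
    (hx : x ∈ majoranaAlgebra a Set.univ) : ha.expect N x ∈ majoranaAlgebra a N := by
  classical
  obtain ⟨F, hF⟩ := exists_finset_mem a hx
  rw [ha.expect_eq_avgProd N hF]
  refine ha.avgProd_mem (fun k hk => (Finset.mem_filter.1 hk).2) (majoranaAlgebra_mono a ?_ hF)
  intro k hk
  by_cases h : k ∈ N
  · exact Or.inr h
  · exact Or.inl (by simpa using ⟨hk, h⟩)

theorem IsFermionAlgebra.expect_mem_closure (N : Set (Λ × Bool)) (x : A) :
    ha.expect N x ∈ closure (majoranaAlgebra a N : Set A) :=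
  map_mem_closure (ha.continuous_expect N) (ha.dense x) fun _ hy => ha.expect_mem_of_mem N hy

theorem IsFermionAlgebra.expect_eq_self_of_flip {N : Set (Λ × Bool)} {x : A}
    (h : ∀ k ∉ N, flip a k x = x) : ha.expect N x = x := by
  classical
  refine tendsto_nhds_unique (ha.tendsto_expect N x) (tendsto_const_nhds.congr fun F => ?_)
  exact (ha.avgProd_eq_self fun k hk => h k (Finset.mem_filter.1 hk).2).symm

/-- The closed algebra generated by `N` is the fixed point algebra of the other flips. -/
theorem IsFermionAlgebra.mem_closure_iff {N : Set (Λ × Bool)} {x : A} :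
    x ∈ closure (majoranaAlgebra a N : Set A) ↔ ∀ k ∉ N, flip a k x = x :=
  ⟨fun hx _ hk => ha.flip_eq_self_of_mem hk hx, fun h => by
    rw [← ha.expect_eq_self_of_flip h]; exact ha.expect_mem_closure N x⟩

theorem IsFermionAlgebra.mem_localAlgebra_iff_flip {I : Set Λ} {x : A} :
    x ∈ localAlgebra a I ↔ ∀ k : Λ × Bool, k.1 ∉ I → flip a k x = x := by
  rw [mem_localAlgebra_iff, ha.mem_closure_iff]; rfl

theorem IsFermionAlgebra.flip_expect {N : Set (Λ × Bool)} {k : Λ × Bool} (hk : k ∉ N) (x : A) :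
    flip a k (ha.expect N x) = ha.expect N x :=
  ha.mem_closure_iff.1 (ha.expect_mem_closure N x) k hk

/-- On algebraic elements `expect` is a finite average and stays algebraic. This lets a strictly
local element of the closed algebra 𝒜(I) be written in the generators of I, where a derivation is
computable. -/
theorem IsFermionAlgebra.mem_of_mem_closure {N : Set (Λ × Bool)} {x : A}
    (hx : x ∈ majoranaAlgebra a Set.univ) (h : x ∈ closure (majoranaAlgebra a N : Set A)) :
    x ∈ majoranaAlgebra a N := by
  rw [← ha.expect_eq_self_of_flip (ha.mem_closure_iff.1 h)]
  exact ha.expect_mem_of_mem N hx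

theorem IsFermionAlgebra.avg_expect (N : Set (Λ × Bool)) (k : Λ × Bool) (x : A) :
    avg a k (ha.expect N x) = ha.expect N (avg a k x) := by
  classical
  refine tendsto_nhds_unique ?_ (ha.tendsto_expect N (avg a k x))
  simp only [← ha.avg_avgProd]
  exact ((continuous_avg a k).tendsto _).comp (ha.tendsto_expect N x)

theorem IsFermionAlgebra.expect_avg {N : Set (Λ × Bool)} {k : Λ × Bool} (hk : k ∉ N) (x : A) :
    ha.expect N (avg a k x) = ha.expect N x := by
  rw [← ha.avg_expect]
  exact avg_eq_self_iff.2 (ha.flip_expect hk x)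

theorem IsFermionAlgebra.expect_expect_of_subset {N N' : Set (Λ × Bool)} (h : N ⊆ N') (x : A) :
    ha.expect N (ha.expect N' x) = ha.expect N x := by
  classical
  refine tendsto_nhds_unique
    (((ha.continuous_expect N).tendsto _).comp (ha.tendsto_expect N' x))
    (tendsto_const_nhds.congr fun F => ?_)
  refine (ha.avgProd_induction _ (fun y => ha.expect N y = ha.expect N x)
    (fun k hk y hy => ?_) rfl).symm
  rw [ha.expect_avg (fun hN => (Finset.mem_filter.1 hk).2 (h hN)), hy]

/-- Averages commute with expectations, so the left side is fixed by every flip outside `N` and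
every flip outside `N'`. Applying the expectation onto `N ∩ N'` thus changes nothing, while it
absorbs the other two. -/
theorem IsFermionAlgebra.expect_expect (N N' : Set (Λ × Bool)) (x : A) :
    ha.expect N (ha.expect N' x) = ha.expect (N ∩ N') x := by
  have h : ha.expect (N ∩ N') (ha.expect N (ha.expect N' x)) = ha.expect N (ha.expect N' x) := by
    refine ha.expect_eq_self_of_flip fun k hk => ?_
    by_cases hN : k ∈ N
    · have hN' : k ∉ N' := fun h' => hk ⟨hN, h'⟩
      rw [← avg_eq_self_iff, ha.avg_expect, avg_eq_self_iff.2 (ha.flip_expect hN' x)]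
    · exact ha.flip_expect hN _
  rw [← h, ha.expect_expect_of_subset Set.inter_subset_left,
    ha.expect_expect_of_subset Set.inter_subset_right]

theorem IsFermionAlgebra.expect_mul_right {N : Set (Λ × Bool)} {b : A}
    (hb : b ∈ closure (majoranaAlgebra a N : Set A)) (x : A) :
    ha.expect N (x * b) = ha.expect N x * b := by
  classical
  refine tendsto_nhds_unique (ha.tendsto_expect N (x * b))
    (((ha.tendsto_expect N x).mul_const b).congr fun F => ?_)
  exact (ha.avgProd_mul_right (fun k hk => ha.mem_closure_iff.1 hb k (Finset.mem_filter.1 hk).2)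
    x).symm

theorem IsFermionAlgebra.star_expect (N : Set (Λ × Bool)) (x : A) :
    star (ha.expect N x) = ha.expect N (star x) := by
  classical
  exact tendsto_nhds_unique (ha.tendsto_expect N x).star
    (by simpa only [ha.star_avgProd] using ha.tendsto_expect N (star x))

theorem IsFermionAlgebra.expect_evenOdd (N : Set (Λ × Bool)) (x : A) :
    ha.expect N (evenOdd a x) = evenOdd a (ha.expect N x) := by
  classical
  refine tendsto_nhds_unique (ha.tendsto_expect N (evenOdd a x)) ?_
  simp only [ha.avgProd_evenOdd]
  exact ((continuous_evenOdd a).tendsto _).comp (ha.tendsto_expect N x)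

/-- The expectations onto larger and larger finite regions converge to the identity. -/
theorem IsFermionAlgebra.tendsto_expect_atTop (x : A) :
    Tendsto (fun J : Finset Λ => ha.expect (Prod.fst ⁻¹' (J : Set Λ)) x) atTop (𝓝 x) := by
  have hev : ∀ y ∈ majoranaAlgebra a Set.univ, Tendsto
      (fun J : Finset Λ => ha.expect (Prod.fst ⁻¹' (J : Set Λ)) y) atTop (𝓝 y) := fun y hy => by
    obtain ⟨F, hF⟩ := exists_finset_mem a hy
    refine tendsto_const_nhds.congr' ?_
    filter_upwards [eventually_ge_atTop (F.image Prod.fst)] with J hJ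
    refine (ha.expect_eq_self_of_flip fun k hk => ha.flip_eq_self_of_mem ?_ (subset_closure hF)).symm
    exact fun h => hk (hJ (Finset.mem_image_of_mem _ h))
  obtain ⟨E, hE⟩ := exists_limit_linearMap
    (fun J : Finset Λ => ha.expect (Prod.fst ⁻¹' (J : Set Λ)))
    (fun _ x => ha.norm_expect_le _ x) _ ha.dense fun y hy => ⟨y, hev y hy⟩
  have hcont : Continuous E := AddMonoidHomClass.continuous_of_bound E 1 fun y => by
    rw [one_mul]
    exact le_of_tendsto (hE y).norm (Eventually.of_forall fun _ => ha.norm_expect_le _ y)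
  have hid := congrFun (Continuous.ext_on ha.dense hcont continuous_id fun y hy =>
    tendsto_nhds_unique (hE y) (hev y hy)) x
  simpa only [hid, id] using hE x

/-! ### The tracial state, identification of `condExp`, and even elements -/

theorem IsFermionAlgebra.exists_expect_empty (x : A) : ∃ r : ℂ, ha.expect ∅ x = r • 1 := by
  have h := ha.expect_mem_closure ∅ x
  have hb : majoranaAlgebra a ∅ = ⊥ := by simp [majoranaAlgebra]
  rw [hb] at h
  have hfd : FiniteDimensional ℂ (Subalgebra.toSubmodule (⊥ : Subalgebra ℂ A)) := by
    rw [Algebra.toSubmodule_bot, Submodule.one_eq_span]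
    infer_instance
  have hc : IsClosed ((⊥ : Subalgebra ℂ A) : Set A) :=
    Submodule.closed_of_finiteDimensional (Subalgebra.toSubmodule (⊥ : Subalgebra ℂ A))
  rw [hc.closure_eq] at h
  obtain ⟨r, hr⟩ := Algebra.mem_bot.1 h
  exact ⟨r, by rw [← hr, Algebra.algebraMap_eq_smul_one]⟩

theorem IsFermionAlgebra.expect_empty_evenOdd (x : A) :
    ha.expect ∅ (evenOdd a x) = ha.expect ∅ x := by
  obtain ⟨r, hr⟩ := ha.exists_expect_empty x
  rw [ha.expect_evenOdd, hr, map_smul, map_one]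

theorem IsFermionAlgebra.expect_empty_flip (k : Λ × Bool) (x : A) :
    ha.expect ∅ (flip a k x) = ha.expect ∅ x := by
  have h := ha.expect_avg (N := ∅) (k := k) (by simp) x
  rw [avg_apply, map_smul, map_add] at h
  have h2 : ha.expect ∅ (flip a k x) =
      (2 : ℂ) • ((1 / 2 : ℂ) • (ha.expect ∅ x + ha.expect ∅ (flip a k x))) - ha.expect ∅ x := by
    module
  rw [h2, h]; module

/-- Traciality against one generator: invariance under the flip and invariance under Θ each cost one
minus sign, and the two cancel. -/
theorem IsFermionAlgebra.expect_empty_majorana_mul (k : Λ × Bool) (x : A) :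
    ha.expect ∅ (x * majorana a k) = ha.expect ∅ (majorana a k * x) := by
  have h1 : ha.expect ∅ (x * majorana a k) = -ha.expect ∅ (majorana a k * evenOdd a x) := by
    rw [← ha.expect_empty_flip k, flip_apply, map_mul (evenOdd a), ha.evenOdd_majorana, mul_neg, mul_neg,
      neg_mul, map_neg]
    simp only [mul_assoc, ha.majorana_mul_self, mul_one]
  have h2 : ha.expect ∅ (majorana a k * evenOdd a x) = -ha.expect ∅ (majorana a k * x) := by
    rw [← ha.expect_empty_evenOdd, map_mul (evenOdd a), ha.evenOdd_majorana, ha.evenOdd_evenOdd, neg_mul,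
      map_neg]
  rw [h1, h2, neg_neg]

theorem IsFermionAlgebra.expect_empty_mul_comm (x y : A) :
    ha.expect ∅ (x * y) = ha.expect ∅ (y * x) := by
  have h : ∀ y ∈ majoranaAlgebra a Set.univ, ∀ x, ha.expect ∅ (x * y) = ha.expect ∅ (y * x) := by
    intro y hy
    induction hy using Algebra.adjoin_induction with
    | mem y hy =>
      obtain ⟨k, -, rfl⟩ := hy
      exact ha.expect_empty_majorana_mul k
    | algebraMap r => intro x; rw [Algebra.commutes]
    | add y z _ _ hy hz => intro x; rw [mul_add, add_mul, map_add, map_add, hy, hz]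
    | mul y z _ _ hy hz => intro x; rw [← mul_assoc, hz, ← mul_assoc, hy, mul_assoc]
  exact congrFun (Continuous.ext_on ha.dense
    ((ha.continuous_expect ∅).comp (continuous_const.mul continuous_id))
    ((ha.continuous_expect ∅).comp (continuous_id.mul continuous_const))
    fun y hy => h y hy x) y

open scoped ComplexOrder in
theorem IsFermionAlgebra.expect_nonneg (N : Set (Λ × Bool)) [PartialOrder A] [StarOrderedRing A]
    {x : A} (hx : 0 ≤ x) : 0 ≤ ha.expect N x := by
  classical
  refine CStarAlgebra.isClosed_nonneg.mem_of_tendsto (ha.tendsto_expect N x)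
    (Eventually.of_forall fun F => ?_)
  refine ha.avgProd_induction _ (fun y => 0 ≤ y) (fun k _ y hy => ?_) hx
  rw [avg_apply]
  have hf : 0 ≤ flip a k y := map_nonneg (ha.flipHom k) hy
  have h2 : (0 : ℂ) ≤ 1 / 2 := by
    rw [Complex.nonneg_iff]; norm_num
  exact smul_nonneg h2 (add_nonneg hy hf)

omit [DecidableEq Λ] ha in
theorem nonneg_of_smul_one_nonneg [Nontrivial A] [PartialOrder A] [StarOrderedRing A] {r : ℂ}
    (h : 0 ≤ r • (1 : A)) : 0 ≤ r.re ∧ r.im = 0 := by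
  have hs : star r • (1 : A) = r • (1 : A) := by
    have := (IsSelfAdjoint.of_nonneg h).star_eq
    rwa [star_smul, star_one] at this
  have hr : star r = r := smul_left_injective ℂ one_ne_zero hs
  have him : r.im = 0 := Complex.conj_eq_iff_im.1 hr
  refine ⟨?_, him⟩
  have hre : r • (1 : A) = algebraMap ℝ A r.re := by
    rw [Algebra.algebraMap_eq_smul_one, ← Complex.coe_smul, Complex.conj_eq_iff_re.1 hr]
  rw [hre] at h
  exact spectrum_nonneg_of_nonneg h (by rw [spectrum.scalar_eq]; rfl)

/-- The expectation onto the scalars, read as a number, is the state; its existence is what gives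
the chosen functional `trace` its properties. -/
theorem IsFermionAlgebra.exists_tracialState [Nontrivial A] :
    ∃ τ : A →ₗ[ℂ] ℂ, IsTracialState τ := by
  choose t ht using ha.exists_expect_empty
  have hu : ∀ {r s : ℂ}, r • (1 : A) = s • 1 → r = s := fun h =>
    smul_left_injective ℂ one_ne_zero h
  let τ : A →ₗ[ℂ] ℂ :=
    { toFun := t
      map_add' := fun x y => hu (by rw [← ht, map_add, ht, ht, add_smul])
      map_smul' := fun c x => hu (by rw [← ht, map_smul, ht, smul_smul]; rfl) }
  refine ⟨τ, ?_, fun x => ?_, fun x y => ?_⟩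
  · refine hu (s := 1) ?_
    change t 1 • (1 : A) = _
    rw [← ht, one_smul]
    exact ha.expect_eq_self_of_flip fun k _ => ha.flip_one k
  · let _ := CStarAlgebra.spectralOrder A
    have := CStarAlgebra.spectralOrderedRing A
    apply nonneg_of_smul_one_nonneg (A := A)
    change 0 ≤ t _ • (1 : A)
    rw [← ht]
    exact ha.expect_nonneg ∅ (star_mul_self_nonneg x)
  · refine hu ?_
    change t _ • (1 : A) = t _ • (1 : A)
    rw [← ht, ← ht, ha.expect_empty_mul_comm]

theorem IsFermionAlgebra.isTracialState_trace [Nontrivial A] : IsTracialState (trace A) :=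
  Classical.epsilon_spec ha.exists_tracialState

omit [DecidableEq Λ] ha in
open scoped ComplexOrder in
theorem IsTracialState.continuous {τ : A →ₗ[ℂ] ℂ} (h : IsTracialState τ) : Continuous τ := by
  let _ := CStarAlgebra.spectralOrder A
  have := CStarAlgebra.spectralOrderedRing A
  have hpos : ∀ x : A, 0 ≤ x → 0 ≤ τ x := fun x hx => by
    obtain ⟨y, rfl⟩ := CStarAlgebra.nonneg_iff_eq_star_mul_self.1 hx
    exact Complex.nonneg_iff.2 ⟨(h.nonneg y).1, (h.nonneg y).2.symm⟩
  obtain ⟨C, hC⟩ := (PositiveLinearMap.mk₀ τ hpos).exists_norm_apply_le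
  exact AddMonoidHomClass.continuous_of_bound τ C hC

/-- A tracial state is Θ-invariant and sees c Θ(x) c as Θ(x), since c² = 1; so it is invariant under
flips, hence under averages and their limits. -/
theorem IsFermionAlgebra.map_expect {τ : A →ₗ[ℂ] ℂ} (h : IsTracialState τ) (N : Set (Λ × Bool))
    (x : A) : τ (ha.expect N x) = τ x := by
  classical
  refine tendsto_nhds_unique ((h.continuous.tendsto _).comp (ha.tendsto_expect N x))
    (tendsto_const_nhds.congr fun F => ?_)
  refine (ha.avgProd_induction _ (fun y => τ y = τ x) (fun k _ y hy => ?_) rfl).symm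
  have hf : τ (flip a k y) = τ y := by
    rw [flip_apply, h.tracial, ha.majorana_mul_cancel, ha.map_evenOdd h.continuous h.tracial]
  rw [avg_apply, map_smul, map_add, hf, hy, smul_eq_mul]
  ring

theorem IsFermionAlgebra.expect_empty_eq [Nontrivial A] (x : A) :
    ha.expect ∅ x = trace A x • 1 := by
  obtain ⟨r, hr⟩ := ha.exists_expect_empty x
  have h := ha.map_expect ha.isTracialState_trace ∅ x
  rw [hr, map_smul, ha.isTracialState_trace.map_one, smul_eq_mul, mul_one] at h
  rw [hr, h]

/-- The trace is nondegenerate on the algebra of finitely many Majorana generators. -/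
theorem IsFermionAlgebra.eq_zero_of_expect_empty_mul (F : Finset (Λ × Bool)) {y : A}
    (hy : ∀ k ∉ F, flip a k y = y)
    (h : ∀ b ∈ majoranaAlgebra a (F : Set (Λ × Bool)), ha.expect ∅ (y * b) = 0) : y = 0 := by
  induction F using Finset.induction_on generalizing y with
  | empty =>
    rw [← ha.expect_eq_self_of_flip (N := ∅) (x := y) (by simpa using hy)]
    simpa using h 1 (one_mem _)
  | insert k F hk ih =>
    have hmono : majoranaAlgebra a (F : Set (Λ × Bool)) ≤
        majoranaAlgebra a ((insert k F : Finset (Λ × Bool)) : Set (Λ × Bool)) :=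
      majoranaAlgebra_mono a (by simp)
    have hfix : ∀ b ∈ majoranaAlgebra a (F : Set (Λ × Bool)), flip a k b = b := fun b hb =>
      ha.flip_eq_self_of_mem (by simpa using hk) (subset_closure hb)
    have h1 : avg a k y = 0 := by
      refine ih (fun l hl => ?_) fun b hb => ?_
      · by_cases hlk : l = k
        · rw [hlk, ha.flip_avg_self]
        · rw [ha.flip_avg, hy l (by simp [hlk, hl])]
      · rw [← ha.avg_mul_right (hfix b hb), ha.expect_avg (by simp)]
        exact h b (hmono hb)
    -- The odd part is detected by the test elements `b * majorana a k`, whose last factor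
    -- traciality moves to the front.
    have h2 : avg a k (majorana a k * y) = 0 := by
      refine ih (fun l hl => ?_) fun b hb => ?_
      · by_cases hlk : l = k
        · rw [hlk, ha.flip_avg_self]
        · rw [ha.flip_avg, ha.flip_mul, hy l (by simp [hlk, hl]), ha.flip_majorana_ne hlk]
      · rw [← ha.avg_mul_right (hfix b hb), ha.expect_avg (by simp), mul_assoc,
          ← ha.expect_empty_majorana_mul, mul_assoc]
        exact h _ (mul_mem (hmono hb) (majorana_mem a (by simp)))
    rw [ha.eq_avg_add k y, h1, h2, mul_zero, add_zero]

/-- For finite regions the conditional expectation is the limit of averages. -/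
theorem IsFermionAlgebra.condExp_eq [Nontrivial A] (J : Finset Λ) (x : A) :
    condExp a (J : Set Λ) x = ha.expect (Prod.fst ⁻¹' (J : Set Λ)) x := by
  have hτ := ha.isTracialState_trace
  have hex : ∀ x, ha.expect (Prod.fst ⁻¹' (J : Set Λ)) x ∈ localAlgebra a (J : Set Λ) ∧
      ∀ b ∈ localAlgebra a (J : Set Λ),
        trace A (x * b) = trace A (ha.expect (Prod.fst ⁻¹' (J : Set Λ)) x * b) := fun x =>
    ⟨(mem_localAlgebra_iff a _ _).2 (ha.expect_mem_closure _ x), fun b hb => by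
      rw [← ha.expect_mul_right ((mem_localAlgebra_iff a _ _).1 hb), ha.map_expect hτ]⟩
  have hsp := Classical.epsilon_spec (p := fun E : A →ₗ[ℂ] A =>
    ∀ x, E x ∈ localAlgebra a (J : Set Λ) ∧ ∀ b ∈ localAlgebra a (J : Set Λ),
      trace A (x * b) = trace A (E x * b)) ⟨_, hex⟩ x
  change condExp a (J : Set Λ) x ∈ _ ∧ ∀ b ∈ _, _ = trace A (condExp a (J : Set Λ) x * b) at hsp
  have hset : ((J ×ˢ Finset.univ : Finset (Λ × Bool)) : Set (Λ × Bool)) =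
      Prod.fst ⁻¹' (J : Set Λ) := by ext; simp
  -- The two candidates differ by an element of 𝒜(J) that is trace-orthogonal to 𝒜(J).
  rw [← sub_eq_zero]
  refine ha.eq_zero_of_expect_empty_mul (J ×ˢ Finset.univ) (fun k hk => ?_) fun b hb => ?_
  · refine ha.mem_localAlgebra_iff_flip.1 (sub_mem hsp.1 (hex x).1) k ?_
    simpa using hk
  · rw [hset] at hb
    have hb' := (mem_localAlgebra_iff a _ _).2 (subset_closure hb)
    rw [ha.expect_empty_eq, sub_mul, map_sub, ← hsp.2 b hb', ← (hex x).2 b hb', sub_self, zero_smul]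

/-- On even elements Θ drops out and the flip is conjugation by the generator. This is how
commutation becomes localization, and why evenness is needed. -/
theorem IsFermionAlgebra.flip_eq_self_iff_of_even {x : A} (hx : evenOdd a x = x) (k : Λ × Bool) :
    flip a k x = x ↔ majorana a k * x = x * majorana a k := by
  rw [flip_apply, hx]
  constructor
  · intro h
    conv_rhs => rw [← h]
    rw [mul_assoc, ha.majorana_mul_self, mul_one]
  · intro h
    rw [h, mul_assoc, ha.majorana_mul_self, mul_one]

/-- An even element fixed by the flips in `N` commutes with the algebra generated by `N`. -/
theorem IsFermionAlgebra.mul_comm_of_even {x : A} (hx : evenOdd a x = x) {N : Set (Λ × Bool)}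
    (h : ∀ k ∈ N, flip a k x = x) {y : A} (hy : y ∈ closure (majoranaAlgebra a N : Set A)) :
    x * y = y * x := by
  refine closure_minimal (t := {y | x * y = y * x}) (fun z hz => ?_) (isClosed_eq
    (continuous_const.mul continuous_id) (continuous_id.mul continuous_const)) hy
  have hle : majoranaAlgebra a N ≤ Subalgebra.centralizer ℂ {x} := by
    refine Algebra.adjoin_le ?_
    rintro _ ⟨k, hk, rfl⟩
    rw [SetLike.mem_coe, Subalgebra.mem_centralizer_iff]
    rintro _ rfl
    exact ((ha.flip_eq_self_iff_of_even hx k).1 (h k hk)).symm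
  exact Subalgebra.mem_centralizer_iff ℂ |>.1 (hle hz) x rfl

/-! ### Derivations and their local Hamiltonians -/

section Derivation
variable {δ : strictlyLocal a →ₗ[ℂ] A} (hδ : IsEvenStarDerivation a δ)

omit [DecidableEq Λ] ha in
theorem majorana_mem_strictlyLocal (a : Λ → A) (k : Λ × Bool) : majorana a k ∈ strictlyLocal a :=
  (mem_strictlyLocal_iff a _).2 (majorana_mem a (Set.mem_univ k))

include hδ

omit [DecidableEq Λ] ha in
theorem IsEvenStarDerivation.map_one : δ 1 = 0 := by
  have h := hδ.leibniz 1 1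
  simpa using h

/-- A derivation is inner on the generators of any finite region, with an even skew-adjoint
implementing element. -/
theorem IsFermionAlgebra.exists_inner_majorana (F : Finset (Λ × Bool)) :
    ∃ h : A, star h = -h ∧ evenOdd a h = h ∧ ∀ k ∈ F,
      δ ⟨majorana a k, majorana_mem_strictlyLocal a k⟩ = h * majorana a k - majorana a k * h := by
  induction F using Finset.induction_on with
  | empty => exact ⟨0, by simp, by simp, by simp⟩
  | insert k F hk ih =>
    obtain ⟨h, hs, he, hF⟩ := ih
    let m : Λ × Bool → strictlyLocal a := fun l =>
      ⟨majorana a l, majorana_mem_strictlyLocal a l⟩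
    have hm : ∀ l, ((m l : strictlyLocal a) : A) = majorana a l := fun _ => rfl
    set c := majorana a k with hc
    have hcc : c * c = 1 := ha.majorana_mul_self k
    have hcs : star c = c := star_majorana a k
    have hce : evenOdd a c = -c := ha.evenOdd_majorana k
    -- The defect of `h` at the new generator. Differentiating c² = 1 and the anticommutation
    -- relations shows that `d` anticommutes with c and with the generators in `F`.
    set d := δ (m k) - (h * c - c * h) with hd
    have hds : star d = d := by
      have h1 : star (m k) = m k := Subtype.ext (star_majorana a k)
      rw [hd, star_sub, ← hδ.map_star, h1, star_sub, star_mul, star_mul, hs, hcs]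
      noncomm_ring
    have hde : evenOdd a d = -d := by
      have h1 := hδ.evenOdd_comm (m k) (-m k) (ha.evenOdd_majorana k).symm
      rw [map_neg] at h1
      rw [hd, map_sub, ← h1, map_sub, map_mul, map_mul, he, hce]
      noncomm_ring
    have hdc : d * c = -(c * d) := by
      have h1 : δ (m k) * c + c * δ (m k) = 0 := by
        have h2 : m k * m k = 1 := Subtype.ext hcc
        have := hδ.leibniz (m k) (m k)
        rw [h2, hδ.map_one] at this
        exact this.symm
      rw [eq_neg_iff_add_eq_zero]
      calc d * c + c * d = (δ (m k) * c + c * δ (m k)) - (h * (c * c) - (c * c) * h) := by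
            rw [hd]; noncomm_ring
        _ = 0 := by rw [h1, hcc]; simp
    have hdl : ∀ l ∈ F, d * majorana a l = -(majorana a l * d) := by
      intro l hl
      have hne : k ≠ l := by rintro rfl; exact hk hl
      have hac : c * majorana a l + majorana a l * c = 0 :=
        eq_neg_iff_add_eq_zero.1 (ha.majorana_anticomm hne)
      have h1 : δ (m k) * majorana a l + majorana a l * δ (m k) =
          -(c * δ (m l) + δ (m l) * c) := by
        have h2 : m k * m l + m l * m k = 0 := Subtype.ext hac
        have h3 := congrArg δ h2
        rw [map_add, hδ.leibniz, hδ.leibniz, map_zero, hm, hm] at h3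
        rw [eq_neg_iff_add_eq_zero, ← h3]
        abel
      rw [eq_neg_iff_add_eq_zero]
      calc d * majorana a l + majorana a l * d
          = (δ (m k) * majorana a l + majorana a l * δ (m k))
            - ((h * c - c * h) * majorana a l + majorana a l * (h * c - c * h)) := by
            rw [hd]; noncomm_ring
        _ = (c * majorana a l + majorana a l * c) * h
            - h * (c * majorana a l + majorana a l * c) := by
            rw [h1, hF l hl]; noncomm_ring
        _ = 0 := by rw [hac]; simp
    -- The element d c commutes with the generators in `F`, so the old commutators survive, and [d
    -- c, c] = 2 d explains the factor 1/2.
    refine ⟨h + (1 / 2 : ℂ) • (d * c), ?_, ?_, ?_⟩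
    · rw [star_add, star_smul, star_mul, hs, hds, hcs, hdc]
      simp only [star_div₀, star_one, star_ofNat]
      module
    · rw [map_add, map_smul, map_mul, he, hde, hce, neg_mul_neg]
    · intro l hl
      rcases Finset.mem_insert.1 hl with rfl | hl
      · have h1 : δ (m l) = d + (h * c - c * h) := by rw [hd]; abel
        have h2 : d * c * c = d := by rw [mul_assoc, hcc, mul_one]
        have h3 : c * (d * c) = -d := by
          rw [← mul_assoc, ← neg_eq_iff_eq_neg.2 hdc, neg_mul, h2]
        change δ (m l) = _
        rw [h1, add_mul, mul_add, smul_mul_assoc, mul_smul_comm, h2, h3]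
        module
      · have hne : k ≠ l := by rintro rfl; exact hk hl
        have h1 : d * c * majorana a l = majorana a l * (d * c) := by
          rw [mul_assoc, ha.majorana_anticomm hne, mul_neg, ← mul_assoc, hdl l hl, neg_mul,
            neg_neg, mul_assoc]
        rw [hF l hl, add_mul, mul_add, smul_mul_assoc, mul_smul_comm, h1]
        abel

omit [DecidableEq Λ] ha in
theorem IsEvenStarDerivation.eq_commutator {N : Set (Λ × Bool)} {h : A}
    (hN : ∀ k ∈ N, δ ⟨majorana a k, majorana_mem_strictlyLocal a k⟩ =
      h * majorana a k - majorana a k * h) {x : A} (hx : x ∈ majoranaAlgebra a N) :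
    ∀ hx' : x ∈ strictlyLocal a, δ ⟨x, hx'⟩ = h * x - x * h := by
  have hle : ∀ y ∈ majoranaAlgebra a N, y ∈ strictlyLocal a := fun y hy =>
    (mem_strictlyLocal_iff a y).2 (majoranaAlgebra_mono a (Set.subset_univ N) hy)
  induction hx using Algebra.adjoin_induction with
  | mem x hx =>
    obtain ⟨k, hk, rfl⟩ := hx
    exact fun _ => hN k hk
  | algebraMap r =>
    intro hx'
    have h1 : (⟨algebraMap ℂ A r, hx'⟩ : strictlyLocal a) = r • 1 :=
      Subtype.ext (Algebra.algebraMap_eq_smul_one r)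
    rw [h1, map_smul, hδ.map_one, smul_zero, Algebra.commutes, sub_self]
  | add x y hx hy ihx ihy =>
    intro hx'
    have h1 : (⟨x + y, hx'⟩ : strictlyLocal a) = ⟨x, hle x hx⟩ + ⟨y, hle y hy⟩ := rfl
    rw [h1, map_add, ihx, ihy]
    noncomm_ring
  | mul x y hx hy ihx ihy =>
    intro hx'
    have h1 : (⟨x * y, hx'⟩ : strictlyLocal a) = ⟨x, hle x hx⟩ * ⟨y, hle y hy⟩ := rfl
    rw [h1, hδ.leibniz, ihx, ihy]
    noncomm_ring

/-- The local Hamiltonians of a derivation, normalized to have no component outside the region. -/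
theorem IsFermionAlgebra.exists_hamiltonian (I : Finset Λ) :
    ∃ H : A, star H = H ∧ evenOdd a H = H ∧ ha.expect (Prod.fst ⁻¹' (I : Set Λ))ᶜ H = 0 ∧
      ∀ x : strictlyLocal a, (x : A) ∈ localAlgebra a (I : Set Λ) →
        δ x = Complex.I • (H * (x : A) - (x : A) * H) := by
  obtain ⟨h, hs, he, hF⟩ := ha.exists_inner_majorana hδ (I ×ˢ Finset.univ)
  set N : Set (Λ × Bool) := Prod.fst ⁻¹' (I : Set Λ) with hN
  set G : A := -Complex.I • h with hG
  have hGs : star G = G := by simp [hG, hs]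
  have hGe : evenOdd a G = G := by rw [hG, map_smul, he]
  -- The subtracted part is even and lies in the algebra of the complement, so it commutes with 𝒜(I)
  -- and the commutators are unchanged.
  refine ⟨G - ha.expect Nᶜ G, ?_, ?_, ?_, fun x hx => ?_⟩
  · rw [star_sub, ha.star_expect, hGs]
  · rw [map_sub, ← ha.expect_evenOdd, hGe]
  · rw [map_sub, ha.expect_expect, Set.inter_self, sub_self]
  · have hx1 := (mem_localAlgebra_iff a _ _).1 hx
    have hx2 := ha.mem_of_mem_closure ((mem_strictlyLocal_iff a _).1 x.2) hx1
    have h1 := hδ.eq_commutator (N := N) (h := h) (fun k hk => hF k (by simpa [hN] using hk)) hx2 x.2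
    have h2 : ha.expect Nᶜ G * (x : A) = x * ha.expect Nᶜ G :=
      ha.mul_comm_of_even (by rw [← ha.expect_evenOdd, hGe])
        (fun k hk => ha.flip_expect (Set.notMem_compl_iff.2 hk) G) hx1
    have h3 : δ x = δ ⟨x, x.2⟩ := rfl
    rw [h3, h1, sub_mul, mul_sub, h2, sub_sub_sub_cancel_right, hG, smul_mul_assoc, mul_smul_comm,
      ← smul_sub, smul_smul]
    simp

end Derivation

/-- Two even elements implementing the same commutators on a region, both without component
outside the region, agree. -/
theorem IsFermionAlgebra.eq_of_commutator_eq {N : Set (Λ × Bool)} {H H' : A}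
    (he : evenOdd a H = H) (he' : evenOdd a H' = H') (h : ha.expect Nᶜ H = 0)
    (h' : ha.expect Nᶜ H' = 0) (hc : ∀ k ∈ N, H * majorana a k - majorana a k * H =
      H' * majorana a k - majorana a k * H') : H = H' := by
  -- The difference is even and commutes with the generators in `N`, so it belongs to the algebra of
  -- the complement, where the normalization kills it.
  have h1 : ha.expect Nᶜ (H - H') = H - H' := by
    refine ha.expect_eq_self_of_flip fun k hk => ?_
    rw [ha.flip_eq_self_iff_of_even (by rw [map_sub, he, he']), ← sub_eq_zero]
    have := hc k (by simpa using hk)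
    rw [← sub_eq_zero] at this
    rw [← neg_eq_zero, ← this]
    noncomm_ring
  rw [map_sub, h, h', sub_zero] at h1
  exact (sub_eq_zero.1 h1.symm)

end CAR

/-! ### Möbius inversion and components of exact support -/

/-- Möbius inversion over the subsets of a finite set. -/
theorem sum_powerset_sum_powerset {Λ M : Type*} [DecidableEq Λ] [AddCommGroup M]
    (f : Finset Λ → M) (J : Finset Λ) :
    ∑ K ∈ J.powerset, ∑ L ∈ K.powerset, (-1 : ℤ) ^ (K.card + L.card) • f L = f J := by
  induction J using Finset.induction_on generalizing f with
  | empty => simp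
  | insert j J hj ih =>
    -- Adjoining `j` to `K` replaces `f` by its difference in direction `j`, so the induction
    -- hypothesis is used for `f` and for this difference; the two values telescope.
    have h : ∀ K ∈ J.powerset, ∑ L ∈ (insert j K).powerset,
        (-1 : ℤ) ^ ((insert j K).card + L.card) • f L =
        ∑ L ∈ K.powerset, (-1 : ℤ) ^ (K.card + L.card) • (f (insert j L) - f L) := by
      intro K hK
      have hjK : j ∉ K := fun h => hj (Finset.mem_powerset.1 hK h)
      rw [Finset.sum_powerset_insert hjK, ← Finset.sum_add_distrib]
      refine Finset.sum_congr rfl fun L hL => ?_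
      have hjL : j ∉ L := fun h => hjK (Finset.mem_powerset.1 hL h)
      rw [Finset.card_insert_of_notMem hjK, Finset.card_insert_of_notMem hjL]
      have e1 : (-1 : ℤ) ^ (K.card + 1 + L.card) = -(-1) ^ (K.card + L.card) := by ring
      have e2 : (-1 : ℤ) ^ (K.card + 1 + (L.card + 1)) = (-1) ^ (K.card + L.card) := by ring
      rw [e1, e2, smul_sub, neg_smul]
      abel
    rw [Finset.sum_powerset_insert hj, Finset.sum_congr rfl h, ih f,
      ih fun L => f (insert j L) - f L]
    abel

section CAR
variable [DecidableEq Λ] {a : Λ → A} (ha : IsFermionAlgebra a)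

/-- The conditional expectation onto the algebra of a region of sites. -/
def IsFermionAlgebra.regionExpect (I : Set Λ) : A →ₗ[ℂ] A := ha.expect (Prod.fst ⁻¹' I)

/-- The component of an element that lives on exactly the sites of `K`. -/
def IsFermionAlgebra.component (K : Finset Λ) (x : A) : A :=
  ∑ L ∈ K.powerset, (-1 : ℤ) ^ (K.card + L.card) • ha.regionExpect (L : Set Λ) x

theorem IsFermionAlgebra.regionExpect_regionExpect (I J : Set Λ) (x : A) :
    ha.regionExpect I (ha.regionExpect J x) = ha.regionExpect (I ∩ J) x :=
  ha.expect_expect _ _ x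

theorem IsFermionAlgebra.regionExpect_eq_self {I : Set Λ} {x : A} (h : x ∈ localAlgebra a I) :
    ha.regionExpect I x = x :=
  ha.expect_eq_self_of_flip (ha.mem_localAlgebra_iff_flip.1 h)

theorem IsFermionAlgebra.sum_component (J : Finset Λ) (x : A) :
    ∑ K ∈ J.powerset, ha.component K x = ha.regionExpect (J : Set Λ) x :=
  sum_powerset_sum_powerset (fun L : Finset Λ => ha.regionExpect (L : Set Λ) x) J

theorem IsFermionAlgebra.component_sub (K : Finset Λ) (x y : A) :
    ha.component K (x - y) = ha.component K x - ha.component K y := by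
  simp only [component, map_sub, smul_sub, Finset.sum_sub_distrib]

/-- The subsets of `K` pair off as `L` and `insert i L`, with opposite signs. -/
theorem sum_powerset_eq_zero {M : Type*} [AddCommGroup M] {K : Finset Λ} {i : Λ}
    (hi : i ∈ K) (f : Finset Λ → M) (hf : ∀ L ⊆ K, i ∉ L → f (insert i L) = f L) :
    ∑ L ∈ K.powerset, (-1 : ℤ) ^ (K.card + L.card) • f L = 0 := by
  have hi' : i ∉ K.erase i := Finset.notMem_erase i K
  conv_lhs => rw [← Finset.insert_erase hi]
  rw [Finset.sum_powerset_insert hi', ← Finset.sum_add_distrib]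
  refine Finset.sum_eq_zero fun L hL => ?_
  have hiL : i ∉ L := fun h => hi' (Finset.mem_powerset.1 hL h)
  rw [hf L ((Finset.mem_powerset.1 hL).trans (Finset.erase_subset _ _)) hiL,
    Finset.card_insert_of_notMem hiL, ← add_assoc, pow_succ]
  simp

theorem IsFermionAlgebra.component_eq_zero_of_regionExpect {K : Finset Λ} {i : Λ} (hi : i ∈ K)
    {x : A} (hx : ha.regionExpect {i}ᶜ x = x) : ha.component K x = 0 := by
  refine sum_powerset_eq_zero hi _ fun L _ hiL => ?_
  have hset : ((insert i L : Finset Λ) : Set Λ) ∩ {i}ᶜ = (L : Set Λ) ∩ {i}ᶜ := by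
    ext j
    by_cases h : j = i <;> simp [h]
  rw [← hx, ha.regionExpect_regionExpect, ha.regionExpect_regionExpect, hset]

/-- Intersecting with a region that misses `i` cannot distinguish `L` from `insert i L`, so the
alternating sum cancels. This yields the standardness condition of the constructed potential. -/
theorem IsFermionAlgebra.regionExpect_component {K : Finset Λ} {J : Set Λ} {i : Λ} (hi : i ∈ K)
    (hJ : i ∉ J) (x : A) : ha.regionExpect J (ha.component K x) = 0 := by
  rw [component, map_sum]
  simp only [map_zsmul]
  refine sum_powerset_eq_zero hi _ fun L _ hiL => ?_
  have hset : J ∩ ((insert i L : Finset Λ) : Set Λ) = J ∩ (L : Set Λ) := by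
    ext j
    by_cases h : j = i <;> simp [h, hJ]
  rw [ha.regionExpect_regionExpect, ha.regionExpect_regionExpect, hset]

theorem IsFermionAlgebra.component_eq_zero_of_disjoint {K : Finset Λ} {I : Set Λ}
    (h : (K : Set Λ) ⊆ Iᶜ) {x : A} (hx : ha.regionExpect Iᶜ x = 0) : ha.component K x = 0 := by
  refine Finset.sum_eq_zero fun L hL => ?_
  have hL' : (L : Set Λ) ∩ Iᶜ = L :=
    Set.inter_eq_left.2 ((Finset.coe_subset.2 (Finset.mem_powerset.1 hL)).trans h)
  rw [← hL', ← ha.regionExpect_regionExpect, hx, map_zero, smul_zero]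

theorem IsFermionAlgebra.component_mem (K : Finset Λ) (x : A) :
    ha.component K x ∈ localAlgebra a (K : Set Λ) := by
  refine sum_mem fun L hL => zsmul_mem ?_ _
  rw [ha.mem_localAlgebra_iff_flip]
  intro k hk
  exact ha.flip_expect (fun h => hk (Finset.mem_powerset.1 hL h)) x

theorem IsFermionAlgebra.star_component (K : Finset Λ) {x : A} (hx : star x = x) :
    star (ha.component K x) = ha.component K x := by
  simp only [component, star_sum, star_zsmul, regionExpect, ha.star_expect, hx]

theorem IsFermionAlgebra.evenOdd_component (K : Finset Λ) {x : A} (hx : evenOdd a x = x) :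
    evenOdd a (ha.component K x) = ha.component K x := by
  simp only [component, map_sum, map_zsmul, regionExpect, ← ha.expect_evenOdd, hx]

/-! ### Hamiltonians of a standard potential -/

section Potential
variable [Nontrivial A] {Φ : Finset Λ → A} (hΦ : IsStandardPotential a Φ)
include hΦ

/-- Since `Φ K` is its own expectation onto `K`, only `L ∩ K` matters, and this is a proper finite
subset of `K`. Standardness thereby extends to arbitrary regions, including infinite complements. -/
theorem IsFermionAlgebra.regionExpect_potential (K : Finset Λ) {L : Set Λ}
    (h : ¬(K : Set Λ) ⊆ L) : ha.regionExpect L (Φ K) = 0 := by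
  classical
  have hc : L ∩ (K : Set Λ) = ((K.filter (· ∈ L) : Finset Λ) : Set Λ) := by
    ext; simp [and_comm]
  rw [← ha.regionExpect_eq_self (hΦ.mem K), ha.regionExpect_regionExpect, hc, regionExpect,
    ← ha.condExp_eq]
  refine hΦ.standard _ _ (Finset.filter_subset _ _) fun he => h fun i hi => ?_
  rw [← he] at hi
  simpa using (Finset.mem_filter.1 hi).2

omit [Nontrivial A] in
theorem IsFermionAlgebra.regionExpect_potential_of_subset {K : Finset Λ} {L : Set Λ}
    (h : (K : Set Λ) ⊆ L) : ha.regionExpect L (Φ K) = Φ K :=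
  ha.regionExpect_eq_self (ha.mem_localAlgebra_iff_flip.2 fun k hk =>
    ha.mem_localAlgebra_iff_flip.1 (hΦ.mem K) k fun h' => hk (h h'))

theorem IsFermionAlgebra.regionExpect_partialHamiltonian (I : Finset Λ) {J J' : Finset Λ}
    (h : J ⊆ J') : ha.regionExpect (J : Set Λ) (partialHamiltonian Φ I J') =
      partialHamiltonian Φ I J := by
  rw [partialHamiltonian, partialHamiltonian, map_sum]
  symm
  refine Finset.sum_subset_zero_on_sdiff ?_ ?_ ?_
  · intro K hK
    simp only [Finset.mem_filter, Finset.mem_powerset] at hK ⊢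
    exact ⟨hK.1.trans h, hK.2⟩
  · intro K hK
    simp only [Finset.mem_sdiff, Finset.mem_filter, Finset.mem_powerset] at hK
    exact ha.regionExpect_potential hΦ K fun hKJ => hK.2 ⟨Finset.coe_subset.1 hKJ, hK.1.2⟩
  · intro K hK
    simp only [Finset.mem_filter, Finset.mem_powerset] at hK
    exact (ha.regionExpect_potential_of_subset hΦ (Finset.coe_subset.2 hK.1)).symm

variable {I : Finset Λ} {H : A}
  (hH : Tendsto (fun J : Finset Λ => partialHamiltonian Φ I J) atTop (𝓝 H))
include hH

/-- The partial Hamiltonians form a martingale closed by its limit, so they can be read back from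
`H`. -/
theorem IsFermionAlgebra.regionExpect_hamiltonian (J : Finset Λ) :
    ha.regionExpect (J : Set Λ) H = partialHamiltonian Φ I J := by
  refine tendsto_nhds_unique (((ha.continuous_expect _).tendsto H).comp hH)
    (tendsto_const_nhds.congr' ?_)
  filter_upwards [eventually_ge_atTop J] with J' h
  exact (ha.regionExpect_partialHamiltonian hΦ I h).symm

theorem IsFermionAlgebra.regionExpect_compl_hamiltonian :
    ha.regionExpect (I : Set Λ)ᶜ H = 0 := by
  refine tendsto_nhds_unique (((ha.continuous_expect _).tendsto H).comp hH)
    (tendsto_const_nhds.congr fun J => ?_)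
  change 0 = ha.regionExpect (I : Set Λ)ᶜ (partialHamiltonian Φ I J)
  rw [partialHamiltonian, map_sum]
  refine (Finset.sum_eq_zero fun K hK => ?_).symm
  obtain ⟨i, hi⟩ := (Finset.mem_filter.1 hK).2
  rw [Finset.mem_inter] at hi
  exact ha.regionExpect_potential hΦ K fun h => h hi.1 hi.2

omit [Nontrivial A]

theorem IsStandardPotential.evenOdd_hamiltonian : evenOdd a H = H := by
  refine tendsto_nhds_unique (((continuous_evenOdd a).tendsto H).comp hH) (hH.congr fun J => ?_)
  simp [partialHamiltonian, hΦ.even]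

theorem IsStandardPotential.star_hamiltonian : star H = H := by
  refine tendsto_nhds_unique hH.star (hH.congr fun J => ?_)
  simp [partialHamiltonian, hΦ.selfAdjoint]

include ha in
/-- The Hamiltonians of nested regions implement the same commutators on the smaller one. -/
theorem IsFermionAlgebra.commutator_hamiltonian_eq {I' : Finset Λ} {H' : A} (hI : I ⊆ I')
    (hH' : Tendsto (fun J : Finset Λ => partialHamiltonian Φ I' J) atTop (𝓝 H')) {x : A}
    (hx : x ∈ localAlgebra a (I : Set Λ)) : H * x - x * H = H' * x - x * H' := by
  have heven : evenOdd a (H' - H) = H' - H := by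
    rw [map_sub, hΦ.evenOdd_hamiltonian hH, hΦ.evenOdd_hamiltonian hH']
  -- The terms surviving in `H' - H` are the `Φ K` with `K` disjoint from `I`, and flips at sites of
  -- `I` fix these.
  have hflip : ∀ k ∈ Prod.fst ⁻¹' (I : Set Λ), flip a k (H' - H) = H' - H := by
    intro k hk
    refine tendsto_nhds_unique (((continuous_flip a k).tendsto _).comp (hH'.sub hH))
      ((hH'.sub hH).congr fun J => ?_)
    simp only [Function.comp, partialHamiltonian, Finset.sum_filter, ← Finset.sum_sub_distrib,
      map_sum]
    refine Finset.sum_congr rfl fun K _ => ?_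
    by_cases h : (K ∩ I).Nonempty
    · rw [if_pos h, if_pos (h.mono (Finset.inter_subset_inter_left hI)), sub_self, map_zero]
    · rw [if_neg h, sub_zero]
      split_ifs
      · refine (ha.mem_localAlgebra_iff_flip.1 (hΦ.mem K) k fun hkK => h ⟨k.1, ?_⟩).symm
        exact Finset.mem_inter.2 ⟨hkK, hk⟩
      · rw [map_zero]
  have hcomm := ha.mul_comm_of_even heven hflip ((mem_localAlgebra_iff a _ _).1 hx)
  rw [sub_mul, mul_sub] at hcomm
  rw [← sub_eq_zero] at hcomm ⊢
  rw [← neg_eq_zero, ← hcomm]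
  abel

end Potential

end CAR

/-! ### The correspondence between potentials and derivations -/

section CAR
variable [DecidableEq Λ] {a : Λ → A} (ha : IsFermionAlgebra a)

theorem exists_finset_mem_localAlgebra {x : A} (hx : x ∈ strictlyLocal a) :
    ∃ I : Finset Λ, x ∈ localAlgebra a (I : Set Λ) := by
  obtain ⟨F, hF⟩ := exists_finset_mem a ((mem_strictlyLocal_iff a x).1 hx)
  have hsub : (F : Set (Λ × Bool)) ⊆ Prod.fst ⁻¹' ((F.image Prod.fst : Finset Λ) : Set Λ) :=
    fun k hk => Finset.mem_coe.2 (Finset.mem_image_of_mem Prod.fst hk)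
  exact ⟨F.image Prod.fst, (mem_localAlgebra_iff a _ x).2
    (subset_closure (majoranaAlgebra_mono a hsub hF))⟩

omit [DecidableEq Λ] in
theorem localAlgebra_mono {I J : Set Λ} (h : I ⊆ J) {x : A} (hx : x ∈ localAlgebra a I) :
    x ∈ localAlgebra a J := by
  rw [mem_localAlgebra_iff] at hx ⊢
  exact closure_mono (majoranaAlgebra_mono a (Set.preimage_mono h)) hx

include ha

theorem IsFermionAlgebra.evenOdd_mem {I : Set Λ} {x : A} (hx : x ∈ localAlgebra a I) :
    evenOdd a x ∈ localAlgebra a I := by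
  rw [ha.mem_localAlgebra_iff_flip] at hx ⊢
  intro k hk
  rw [ha.flip_evenOdd, hx k hk]

/-- Every standard potential generates a derivation. -/
theorem IsFermionAlgebra.exists_derivation {Φ : Finset Λ → A} (hΦ : IsStandardPotential a Φ) :
    ∃ δ : strictlyLocal a →ₗ[ℂ] A, IsEvenStarDerivation a δ ∧ Generates a Φ δ := by
  choose H hH using fun I => cauchySeq_tendsto_of_complete (hΦ.cauchy I)
  -- The commutator does not depend on the region: two regions containing `x` are compared through
  -- their union.
  have key : ∀ x : strictlyLocal a, ∃ d : A, ∀ I : Finset Λ, (x : A) ∈ localAlgebra a (I : Set Λ) →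
      d = Complex.I • (H I * (x : A) - (x : A) * H I) := by
    intro x
    obtain ⟨I, hI⟩ := exists_finset_mem_localAlgebra x.2
    refine ⟨Complex.I • (H I * (x : A) - (x : A) * H I), fun J hJ => congrArg (Complex.I • ·) ?_⟩
    exact (ha.commutator_hamiltonian_eq hΦ (hH I) (Finset.subset_union_left (s₂ := J)) (hH _)
      hI).trans (ha.commutator_hamiltonian_eq hΦ (hH J) Finset.subset_union_right (hH _) hJ).symm
  choose d hd using key
  have hcommon : ∀ x y : strictlyLocal a, ∃ I : Finset Λ, (x : A) ∈ localAlgebra a (I : Set Λ) ∧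
      (y : A) ∈ localAlgebra a (I : Set Λ) := by
    intro x y
    obtain ⟨I, hI⟩ := exists_finset_mem_localAlgebra x.2
    obtain ⟨J, hJ⟩ := exists_finset_mem_localAlgebra y.2
    exact ⟨I ∪ J, localAlgebra_mono (by simp) hI, localAlgebra_mono (by simp) hJ⟩
  refine ⟨{ toFun := d, map_add' := fun x y => ?_, map_smul' := fun c x => ?_ },
    ⟨fun x y => ?_, fun x => ?_, fun x y hxy => ?_⟩, fun I => ⟨H I, hH I, fun x hx => hd x I hx⟩⟩
  · obtain ⟨I, hx, hy⟩ := hcommon x y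
    rw [hd x I hx, hd y I hy, hd (x + y) I (add_mem hx hy), ← smul_add]
    congr 1
    change H I * ((x : A) + y) - ((x : A) + y) * H I = _
    noncomm_ring
  · obtain ⟨I, hx, -⟩ := hcommon x x
    rw [hd x I hx, hd (c • x) I (SMulMemClass.smul_mem c hx)]
    change Complex.I • (H I * (c • (x : A)) - (c • (x : A)) * H I) = c • _
    rw [mul_smul_comm, smul_mul_assoc, ← smul_sub, smul_comm]
  · obtain ⟨I, hx, hy⟩ := hcommon x y
    change d (x * y) = d x * y + x * d y
    rw [hd x I hx, hd y I hy, hd (x * y) I (mul_mem hx hy), smul_mul_assoc, mul_smul_comm,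
      ← smul_add]
    congr 1
    change H I * ((x : A) * y) - ((x : A) * y) * H I = _
    noncomm_ring
  · obtain ⟨I, hx, -⟩ := hcommon x x
    change d (star x) = star (d x)
    rw [hd x I hx, hd (star x) I (star_mem hx)]
    change Complex.I • (H I * star (x : A) - star (x : A) * H I) = _
    rw [star_smul, star_sub, star_mul, star_mul, hΦ.star_hamiltonian (hH I), Complex.star_def,
      Complex.conj_I]
    module
  · obtain ⟨I, hx, -⟩ := hcommon x x
    change d y = evenOdd a (d x)
    rw [hd x I hx, hd y I (hxy ▸ ha.evenOdd_mem hx), hxy, map_smul, map_sub, map_mul, map_mul,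
      hΦ.evenOdd_hamiltonian (hH I)]

omit ha in
theorem Generates.derivation_unique {Φ : Finset Λ → A} {δ ε : strictlyLocal a →ₗ[ℂ] A}
    (hδ : Generates a Φ δ) (hε : Generates a Φ ε) : δ = ε := by
  refine LinearMap.ext fun x => ?_
  obtain ⟨I, hI⟩ := exists_finset_mem_localAlgebra x.2
  obtain ⟨H, hH, h⟩ := hδ I
  obtain ⟨H', hH', h'⟩ := hε I
  rw [h x hI, h' x hI, tendsto_nhds_unique hH hH']

omit [DecidableEq Λ] ha in
theorem eq_of_sum_powerset_nonempty_eq {Λ M : Type*} [DecidableEq Λ] [AddCommGroup M]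
    {Φ Ψ : Finset Λ → M} (h0 : Φ ∅ = Ψ ∅)
    (h : ∀ J, ∑ K ∈ J.powerset with (K ∩ J).Nonempty, Φ K =
      ∑ K ∈ J.powerset with (K ∩ J).Nonempty, Ψ K) : Φ = Ψ := by
  funext J
  induction J using Finset.strongInduction with
  | H J ih =>
    rcases J.eq_empty_or_nonempty with rfl | hJ
    · exact h0
    · have hmem : J ∈ J.powerset.filter fun K => (K ∩ J).Nonempty := by simpa using hJ
      have hsum := h J
      rw [← Finset.add_sum_erase _ _ hmem, ← Finset.add_sum_erase _ _ hmem] at hsum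
      have hrest : ∑ K ∈ (J.powerset.filter fun K => (K ∩ J).Nonempty).erase J, Φ K =
          ∑ K ∈ (J.powerset.filter fun K => (K ∩ J).Nonempty).erase J, Ψ K := by
        refine Finset.sum_congr rfl fun K hK => ih K ?_
        simp only [Finset.mem_erase, Finset.mem_filter, Finset.mem_powerset] at hK
        exact Finset.ssubset_iff_subset_ne.2 ⟨hK.2.1, hK.1⟩
      rw [hrest] at hsum
      exact add_right_cancel hsum

/-- Both limit Hamiltonians of `J` are even, normalized and implement `δ`, so they coincide. Their
expectations onto `J` are the sums over the nonempty subsets of `J`, which determine the potential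
inductively. -/
theorem IsFermionAlgebra.potential_unique [Nontrivial A] {Φ Ψ : Finset Λ → A}
    (hΦ : IsStandardPotential a Φ) (hΨ : IsStandardPotential a Ψ) {δ : strictlyLocal a →ₗ[ℂ] A}
    (h : Generates a Φ δ) (h' : Generates a Ψ δ) : Φ = Ψ := by
  refine eq_of_sum_powerset_nonempty_eq (hΦ.empty.trans hΨ.empty.symm) fun J => ?_
  obtain ⟨H, hH, hc⟩ := h J
  obtain ⟨H', hH', hc'⟩ := h' J
  have heq : H = H' := by
    refine ha.eq_of_commutator_eq (N := Prod.fst ⁻¹' (J : Set Λ)) (hΦ.evenOdd_hamiltonian hH)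
      (hΨ.evenOdd_hamiltonian hH') (ha.regionExpect_compl_hamiltonian hΦ hH)
      (ha.regionExpect_compl_hamiltonian hΨ hH') fun k hk => ?_
    have hm : majorana a k ∈ localAlgebra a (J : Set Λ) :=
      (mem_localAlgebra_iff a _ _).2 (subset_closure (majorana_mem a hk))
    exact smul_right_injective A Complex.I_ne_zero
      ((hc ⟨_, majorana_mem_strictlyLocal a k⟩ hm).symm.trans
        (hc' ⟨_, majorana_mem_strictlyLocal a k⟩ hm))
  change partialHamiltonian Φ J J = partialHamiltonian Ψ J J
  rw [← ha.regionExpect_hamiltonian hΦ hH, ← ha.regionExpect_hamiltonian hΨ hH', heq]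

/-- Every even *-derivation is generated by a standard potential. -/
theorem IsFermionAlgebra.exists_potential [Nontrivial A] {δ : strictlyLocal a →ₗ[ℂ] A}
    (hδ : IsEvenStarDerivation a δ) :
    ∃ Φ : Finset Λ → A, IsStandardPotential a Φ ∧ Generates a Φ δ := by
  choose H hs he h0 hc using fun I => ha.exists_hamiltonian hδ I
  replace h0 : ∀ I : Finset Λ, ha.regionExpect (I : Set Λ)ᶜ (H I) = 0 := h0
  let Φ : Finset Λ → A := fun K => ha.component K (H K)
  -- `H I - H {i}` is even and commutes with the generators at `i`, so it does not involve the site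
  -- `i` and has no component on a set containing `i`.
  have hsingle : ∀ (I : Finset Λ) (i : Λ), i ∈ I → ∀ K : Finset Λ, i ∈ K →
      ha.component K (H I) = ha.component K (H {i}) := by
    intro I i hi K hK
    rw [← sub_eq_zero, ← ha.component_sub]
    refine ha.component_eq_zero_of_regionExpect hK (ha.expect_eq_self_of_flip fun k hk => ?_)
    have hk' : k.1 = i := by simpa using hk
    rw [ha.flip_eq_self_iff_of_even (by rw [map_sub, he, he])]
    have hm : ∀ J : Finset Λ, i ∈ J → majorana a k ∈ localAlgebra a (J : Set Λ) := fun J hJ =>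
      (mem_localAlgebra_iff a _ _).2 (subset_closure (majorana_mem a (by simpa [hk'] using hJ)))
    have h1 : H I * majorana a k - majorana a k * H I =
        H {i} * majorana a k - majorana a k * H {i} :=
      smul_right_injective A Complex.I_ne_zero
        ((hc I ⟨_, majorana_mem_strictlyLocal a k⟩ (hm I hi)).symm.trans
          (hc {i} ⟨_, majorana_mem_strictlyLocal a k⟩ (hm {i} (by simp))))
    rw [← sub_eq_zero] at h1 ⊢
    rw [← neg_eq_zero, ← h1]
    noncomm_ring
  -- If `K` meets `I`, the components of `H K` and `H I` on `K` agree through a common site;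
  -- otherwise the component of `H I` vanishes by normalization. The sum over all `K ⊆ J` is then
  -- Möbius inversion.
  have hpartial : ∀ I J : Finset Λ, partialHamiltonian Φ I J =
      ha.regionExpect (J : Set Λ) (H I) := by
    intro I J
    rw [← ha.sum_component, partialHamiltonian, Finset.sum_filter]
    refine Finset.sum_congr rfl fun K _ => ?_
    split_ifs with hK
    · obtain ⟨i, hi⟩ := hK
      rw [Finset.mem_inter] at hi
      exact (hsingle K i hi.1 K hi.1).trans (hsingle I i hi.2 K hi.1).symm
    · refine (ha.component_eq_zero_of_disjoint (I := (I : Set Λ)) (fun i hi hI => hK ⟨i, ?_⟩)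
        (h0 I)).symm
      exact Finset.mem_inter.2 ⟨hi, hI⟩
  have hlim : ∀ I : Finset Λ, Tendsto (fun J : Finset Λ => partialHamiltonian Φ I J) atTop
      (𝓝 (H I)) := fun I => by
    simp only [hpartial]
    exact ha.tendsto_expect_atTop (H I)
  refine ⟨Φ, ⟨fun I => ha.component_mem I _, ?_, fun I => ha.star_component I (hs I),
    fun I => ha.evenOdd_component I (he I), fun I J hJI hne => ?_, fun I => (hlim I).cauchySeq⟩,
    fun I => ⟨H I, hlim I, hc I⟩⟩
  · exact ha.component_eq_zero_of_disjoint (I := ((∅ : Finset Λ) : Set Λ)) (by simp) (h0 ∅)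
  · obtain ⟨i, hi, hiJ⟩ := Finset.exists_of_ssubset (Finset.ssubset_iff_subset_ne.2 ⟨hJI, hne⟩)
    rw [ha.condExp_eq]
    exact ha.regionExpect_component hi (by simpa using hiJ) _

omit ha in
theorem Generates.add {Φ Ψ : Finset Λ → A} {δ ε : strictlyLocal a →ₗ[ℂ] A}
    (hδ : Generates a Φ δ) (hε : Generates a Ψ ε) : Generates a (Φ + Ψ) (δ + ε) := by
  intro I
  obtain ⟨H, hH, h⟩ := hδ I
  obtain ⟨H', hH', h'⟩ := hε I
  refine ⟨H + H', ?_, fun x hx => ?_⟩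
  · simpa only [partialHamiltonian, Pi.add_apply, Finset.sum_add_distrib] using hH.add hH'
  · rw [LinearMap.add_apply, h x hx, h' x hx, ← smul_add]
    congr 1
    noncomm_ring

omit ha in
theorem Generates.smul {Φ : Finset Λ → A} {δ : strictlyLocal a →ₗ[ℂ] A}
    (hδ : Generates a Φ δ) (c : ℝ) : Generates a (c • Φ) (c • δ) := by
  intro I
  obtain ⟨H, hH, h⟩ := hδ I
  refine ⟨c • H, ?_, fun x hx => ?_⟩
  · simpa only [partialHamiltonian, Pi.smul_apply, Finset.smul_sum] using hH.const_smul c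
  · rw [LinearMap.smul_apply, h x hx, smul_mul_assoc, mul_smul_comm, ← smul_sub, smul_comm]

/-- The generation relation is the graph of a real-linear isomorphism. -/
theorem IsFermionAlgebra.exists_linearEquiv [Nontrivial A] :
    ∃ L : standardPotentials a ≃ₗ[ℝ] evenStarDerivations a,
      ∀ (Φ : standardPotentials a) (δ : evenStarDerivations a),
        L Φ = δ ↔ Generates a (Φ : Finset Λ → A) (δ : strictlyLocal a →ₗ[ℂ] A) := by
  choose f hf hg using fun Φ : standardPotentials a => ha.exists_derivation Φ.2
  let L : standardPotentials a →ₗ[ℝ] evenStarDerivations a :=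
    { toFun := fun Φ => ⟨f Φ, hf Φ⟩
      map_add' := fun Φ Ψ => Subtype.ext ((hg (Φ + Ψ)).derivation_unique ((hg Φ).add (hg Ψ)))
      map_smul' := fun c Φ => Subtype.ext ((hg (c • Φ)).derivation_unique ((hg Φ).smul c)) }
  have hL : ∀ (Φ : standardPotentials a) (δ : evenStarDerivations a),
      L Φ = δ ↔ Generates a (Φ : Finset Λ → A) (δ : strictlyLocal a →ₗ[ℂ] A) := fun Φ δ =>
    ⟨fun h => h ▸ hg Φ, fun h => Subtype.ext ((hg Φ).derivation_unique h)⟩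
  have hbij : Function.Bijective L := by
    refine ⟨fun Φ Ψ h => Subtype.ext ?_, fun δ => ?_⟩
    · exact ha.potential_unique Φ.2 Ψ.2 ((hL Φ _).1 rfl) ((hL Ψ _).1 h.symm)
    · obtain ⟨Φ, hΦ, h⟩ := ha.exists_potential δ.2
      exact ⟨⟨Φ, hΦ⟩, (hL _ _).2 h⟩
  exact ⟨LinearEquiv.ofBijective L hbij, hL⟩

end CAR

end FermionLattice

end

theorem mainTheorem3 (ν : ℕ) (hν : 0 < ν) {A : Type*} [CStarAlgebra A] [Nontrivial A]
    (a : (Fin ν → ℤ) → A) (ha : FermionLattice.IsFermionAlgebra a) :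
    ∃ L : FermionLattice.standardPotentials a ≃ₗ[ℝ] FermionLattice.evenStarDerivations a,
      ∀ (Φ : FermionLattice.standardPotentials a) (δ : FermionLattice.evenStarDerivations a),
        L Φ = δ ↔ FermionLattice.Generates a (Φ : Finset (Fin ν → ℤ) → A)
          (δ : FermionLattice.strictlyLocal a →ₗ[ℂ] A) :=
  ha.exists_linearEquiv
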